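/- Let $(S,\mathscr S)$ be a measurable space, $\mathcal P$ a probability kernel on $S\times\mathscr S^{\otimes 2}$ and $\nu$ a probability measure on $S$. Let $\mathbb G_k=\{0,1\}^k$ be the $k$-th generation of the binary tree $\mathbb T=\bigcup_k\mathbb G_k$, and $\mathbb T_k=\bigcup_{r\le k}\mathbb G_r$. Write $(\mathcal P f)(x)=\int f(x,y,z)\,\mathcal P(x,dy,dz)$ for measurable $f:S^3\to\mathbb R$ and $(\mathcal P h)(x)=\int h(y,z)\,\mathcal P(x,dy,dz)$ for measurable $h:S^2\to\mathbb R$, whenever these integrals exist; let $\mathcal Q=\frac12(P_0+P_1)$, where $P_0,P_1$ are the two marginal kernels of $\mathcal P$, and $(f\otimes g)(y,z)=f(y)g(z)$. Let $X=(X_u)_{u\in\mathbb T}$ be a bifurcating Markov chain with initial law $\nu$ and kernel $\mathcal P$: $X_\emptyset\sim\nu$ and, for all bounded measurable $g_u:S^3\to\mathbb R$ ($u\in\mathbb T$) and all $k\ge 0$, $$\mathbb E\Big[\prod_{u\in\mathbb G_k}g_u(X_u,X_{u0},X_{u1})\,\Big|\,\sigma(X_j;\,j\in\mathbb T_k)\Big]=\prod_{u\in\mathbb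 G_k}\mathcal P g_u(X_u)\quad\text{a.s.}$$ Let $F$ be a vector space of measurable functions $S\to\mathbb R$ that contains the constants and satisfies: $f^2\in F$ for $f\in F$; $F\subset L^1(\nu)$; and, for all $f,g\in F$, $f\otimes g\in L^1(\mathcal P(x,\cdot))$ for every $x\in S$ and $\mathcal P(f\otimes g)\in F$. Let $\mu$ be a probability measure on $S$ with $F\subset L^1(\mu)$ and let $\alpha\in(0,1)$ be such that for every $f\in F$ there is $g\in F$ with $|\mathcal Q^nf-\langle\mu,f\rangle|\le\alpha^n g$ for all $n\in\mathbb N$. Let $\mathfrak f=(f_\ell)_{\ell\in\mathbb N}$ be measurable functions $S^3\to\mathbb R$ such that, for each $m\in\{1,2,4\}$, the functions $h_\ell=\mathcal P(f_\ell^m)$, $\ell\in\mathbb N$, exist, belong to $F$, and satisfy, for some $g\in F$, $|\mathcal Q^n h_\ell|\le g$ and $|\mathcal Q^n h_\ell-\langle\mu,h_\ell\rangle|\le\alpha^n g$ for all $n,\ell\in\mathbb N$. Suppose that $\mathcal P f_\ell=0$ for all $\ell\in\mathbb N$. Put $$N_{n,\emptyset}(\mathfrak f)=|\mathbb G_n|^{-1/2}\sum_{\ell=0}^n\sum_{u\in\mathbb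 G_{n-\ell}}\big(f_\ell(X_u,X_{u0},X_{u1})-\langle\mu,\mathcal P f_\ell\rangle\big).$$ Then the series $\Sigma(\mathfrak f)=\sum_{\ell\ge 0}2^{-\ell}\langle\mu,\mathcal P(f_\ell^2)\rangle$ converges and, as $n\to\infty$, $N_{n,\emptyset}(\mathfrak f)$ converges in distribution to a centred Gaussian random variable with variance $\Sigma(\mathfrak f)$. -/

import Mathlib

open MeasureTheory ProbabilityTheory Filter
open scoped ENNReal NNReal

namespace BMC

noncomputable section

/-! ### The binary tree: vertices are finite words over `{0, 1}` (`false = 0`, `true = 1`). -/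

/-- The `k`-th generation of the binary tree, i.e. the words of length `k`. -/
def gen (k : ℕ) : Finset (List Bool) :=
  (Finset.univ : Finset (Fin k → Bool)).map ⟨List.ofFn, List.ofFn_injective⟩

theorem mem_gen {k : ℕ} {u : List Bool} : u ∈ gen k ↔ u.length = k := by
  simp only [gen, Finset.mem_map, Finset.mem_univ, true_and, Function.Embedding.coeFn_mk]
  constructor
  · rintro ⟨v, rfl⟩
    simp
  · rintro rfl
    exact ⟨u.get, List.ofFn_get u⟩

theorem card_gen (k : ℕ) : (gen k).card = 2 ^ k := by
  simp [gen]

variable {S : Type*} [MeasurableSpace S]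

/-! ### Kernels and their action on functions. -/

/-- `(P f)(x) = ∫ f(x, y, z) P(x, dy, dz)` for a function `f` of three variables. -/
def actTri (P : Kernel S (S × S)) (f : S × S × S → ℝ) (x : S) : ℝ :=
  ∫ p, f (x, p.1, p.2) ∂(P x)

/-- `(P h)(x) = ∫ h(y, z) P(x, dy, dz)` for a function `h` of two variables. -/
def actPair (P : Kernel S (S × S)) (h : S × S → ℝ) (x : S) : ℝ :=
  ∫ p, h p ∂(P x)

/-- The kernel `Q = (P₀ + P₁) / 2`, where `P₀` and `P₁` are the two marginals of `P`. -/
def meanKernel (P : Kernel S (S × S)) : Kernel S S where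
  toFun x := (2⁻¹ : ℝ≥0∞) • ((P.fst + P.snd) x)
  measurable' := by
    refine Measure.measurable_of_measurable_coe _ fun s hs => ?_
    simp only [Measure.smul_apply, smul_eq_mul]
    exact (Kernel.measurable_coe _ hs).const_mul _

instance (P : Kernel S (S × S)) [IsMarkovKernel P] : IsMarkovKernel (meanKernel P) := by
  refine ⟨fun x => ⟨?_⟩⟩
  change ((2⁻¹ : ℝ≥0∞) • ((P.fst + P.snd) x)) Set.univ = 1
  rw [Measure.smul_apply, add_apply, Measure.add_apply, measure_univ, measure_univ,
    smul_eq_mul, one_add_one_eq_two, ENNReal.inv_mul_cancel two_ne_zero ENNReal.ofNat_ne_top]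

/-- `(Q f)(x) = ∫ f(y) Q(x, dy)`. -/
def actQ (P : Kernel S (S × S)) (f : S → ℝ) (x : S) : ℝ :=
  ∫ y, f y ∂(meanKernel P x)

/-- The iterates: `Q⁰ f = f` and `Q^(n+1) f = Q^n (Q f)`. -/
def iterQ (P : Kernel S (S × S)) (n : ℕ) (f : S → ℝ) : S → ℝ :=
  (actQ P)^[n] f

/-- The tensor product `(f ⊗ g)(y, z) = f(y) g(z)`. -/
def tensor (f g : S → ℝ) (p : S × S) : ℝ := f p.1 * g p.2

/-! ### Bifurcating Markov chains. -/

variable {Ω : Type*} [MeasurableSpace Ω]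

/-- The mother-daughters triangle `(X_u, X_{u0}, X_{u1})`. -/
def triangle (X : List Bool → Ω → S) (u : List Bool) (ω : Ω) : S × S × S :=
  (X u ω, X (u ++ [false]) ω, X (u ++ [true]) ω)

/-- The σ-field generated by the `X_j` with `j` in the tree up to generation `k`. -/
@[reducible] def sigmaUpTo (X : List Bool → Ω → S) (k : ℕ) : MeasurableSpace Ω :=
  ⨆ (j : List Bool) (_ : j.length ≤ k), MeasurableSpace.comap (X j) inferInstance

/-- `X` is, under `mP`, a bifurcating Markov chain with initial distribution `ν` and
probability kernel `P`. -/
structure IsBMC (mP : Measure Ω) (ν : Measure S) (P : Kernel S (S × S))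
    (X : List Bool → Ω → S) : Prop where
  measurable : ∀ u, Measurable (X u)
  initial : mP.map (X []) = ν
  branching : ∀ g : List Bool → S × S × S → ℝ,
    (∀ u, Measurable (g u)) → (∀ u, ∃ C, ∀ y, |g u y| ≤ C) →
    ∀ k : ℕ,
      mP[fun ω => ∏ u ∈ gen k, g u (triangle X u ω) | sigmaUpTo X k]
        =ᵐ[mP] fun ω => ∏ u ∈ gen k, actTri P (g u) (X u ω)

/-! ### Assumptions. -/

/-- The structural assumption on a vector space `F` of real measurable functions on `S`. -/
structure Structural (ν : Measure S) (P : Kernel S (S × S)) (F : Submodule ℝ (S → ℝ)) :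
    Prop where
  measurable : ∀ f ∈ F, Measurable f
  const_mem : ∀ c : ℝ, (fun _ : S => c) ∈ F
  sq_mem : ∀ f ∈ F, (fun x => f x ^ 2) ∈ F
  integrable : ∀ f ∈ F, Integrable f ν
  tensor_integrable : ∀ f ∈ F, ∀ g ∈ F, ∀ x, Integrable (tensor f g) (P x)
  tensor_mem : ∀ f ∈ F, ∀ g ∈ F, actPair P (tensor f g) ∈ F

/-- Geometric ergodicity of `Q` on `F`, with limit `μ` and rate `α`. -/
structure GeomErgodic (P : Kernel S (S × S)) (F : Submodule ℝ (S → ℝ)) (μ : Measure S)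
    (α : ℝ) : Prop where
  integrable : ∀ f ∈ F, Integrable f μ
  bound : ∀ f ∈ F, ∃ g ∈ F, ∀ (n : ℕ) (x : S),
    |iterQ P n f x - ∫ y, f y ∂μ| ≤ α ^ n * g x

/-- A sequence `h` of elements of `F` satisfies the ergodic bounds uniformly. -/
def UniformErgodic (P : Kernel S (S × S)) (F : Submodule ℝ (S → ℝ)) (μ : Measure S)
    (α : ℝ) (h : ℕ → S → ℝ) : Prop :=
  (∀ l, h l ∈ F) ∧ ∃ g ∈ F, ∀ (n l : ℕ) (x : S),
    |iterQ P n (h l) x| ≤ g x ∧ |iterQ P n (h l) x - ∫ y, h l y ∂μ| ≤ α ^ n * g x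

/-- `P (f_l ^ m)` exists for all `l`, and these functions form a sequence of elements of `F`
which satisfies the ergodic bounds uniformly. -/
def UniformPower (P : Kernel S (S × S)) (F : Submodule ℝ (S → ℝ)) (μ : Measure S)
    (α : ℝ) (f : ℕ → S × S × S → ℝ) (m : ℕ) : Prop :=
  (∀ l x, Integrable (fun p : S × S => f l (x, p.1, p.2) ^ m) (P x)) ∧
    UniformErgodic P F μ α (fun l => actTri P (fun y => f l y ^ m))

/-! ### The additive functional. -/

/-- `M_A(f) = ∑_{u ∈ A} f(X_u, X_{u0}, X_{u1})`. -/
def addFun (X : List Bool → Ω → S) (A : Finset (List Bool)) (f : S × S × S → ℝ) (ω : Ω) : ℝ :=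
  ∑ u ∈ A, f (triangle X u ω)

/-- The centred function `f - ⟨μ, P f⟩`. -/
def centred (P : Kernel S (S × S)) (μ : Measure S) (f : S × S × S → ℝ) (y : S × S × S) : ℝ :=
  f y - ∫ x, actTri P f x ∂μ

/-- `N_{n,∅}(f) = |G_n|^{-1/2} ∑_{l=0}^n M_{G_{n-l}}(f_l - ⟨μ, P f_l⟩)`. -/
def fluctuation (P : Kernel S (S × S)) (μ : Measure S) (X : List Bool → Ω → S)
    (f : ℕ → S × S × S → ℝ) (n : ℕ) (ω : Ω) : ℝ :=
  (√((gen n).card : ℝ))⁻¹ *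
    ∑ l ∈ Finset.range (n + 1), addFun X (gen (n - l)) (centred P μ (f l)) ω

end

end BMC

/-! Since `P f_l = 0`, centring is void and `N_n` is `2^(-n/2)` times the sum over generations `k ≤
n` of `M_{G_k}(f_{n-k})`. The characteristic function is computed by revealing the tree one
generation at a time. Given the tree up to generation `k`, the triangles rooted there are
independent, so with `s = t 2^(-n/2)` the conditional characteristic function of the new block is a
product over `u ∈ G_k`. Each factor has conditional mean zero, hence equals `exp(-s²/2 ·
P(f_{n-k}²)(X_u))` up to an error controlled by the second and fourth moments
(`norm_integral_cexp_sub_exp_le`).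

The product of these exponentials involves only the generation average of `P(f_{n-k}²)`. A law of
large numbers (`IsBMC.integral_abs_mean_sub_le`) replaces it by its `μ`-mean, so each generation
contributes an almost deterministic factor, and the factors telescope (`norm_sub_prod_le_sum`) to
the Gaussian one. The Taylor errors total `O(2^(-n/2))`. The averaging errors total at most a
constant times `(n+1) ρ^(n/2)` with `ρ = (1+α)/2 < 1`, because the weights `2^(-(n-k))` suppress the
early generations, where averaging is poor.

The law of large numbers is a second moment bound. Conditional independence gives a recursion from
generation `k+1` to `k` in which `h` becomes `Q h`; iterating it uses the decay of `Q^j h` for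
centred `h` (`IsBMC.integral_sum_sq_le_geometric`). -/

namespace BMC

/-! ### The branching property in integrated form, real and complex -/

section Branching

variable {S : Type*} [MeasurableSpace S] {Ω : Type*} [mΩ : MeasurableSpace Ω]
  {mP : Measure Ω} {ν : Measure S} {P : Kernel S (S × S)} {X : List Bool → Ω → S}

theorem IsBMC.sigmaUpTo_le (hX : IsBMC mP ν P X) (k : ℕ) :
    sigmaUpTo X k ≤ mΩ :=
  iSup₂_le fun j _ => (hX.measurable j).comap_le

theorem measurable_sigmaUpTo {Ω : Type*} (X : List Bool → Ω → S) {k : ℕ} {u : List Bool}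
    (hu : u.length ≤ k) :
    Measurable[sigmaUpTo X k] (X u) :=
  (comap_measurable (X u)).mono
    (le_iSup₂_of_le (f := fun (j : List Bool) (_ : j.length ≤ k) =>
      MeasurableSpace.comap (X j) inferInstance) u hu le_rfl) le_rfl

theorem measurable_triangle_sigmaUpTo {Ω : Type*} (X : List Bool → Ω → S) {k : ℕ}
    {u : List Bool} (hu : u.length < k) : Measurable[sigmaUpTo X k] (triangle X u) :=
  (measurable_sigmaUpTo X hu.le).prodMk ((measurable_sigmaUpTo X (by simpa using hu)).prodMk
    (measurable_sigmaUpTo X (by simpa using hu)))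

theorem IsBMC.measurable_triangle (hX : IsBMC mP ν P X) (u : List Bool) :
    Measurable (triangle X u) :=
  (hX.measurable _).prodMk ((hX.measurable _).prodMk (hX.measurable _))

theorem measurable_integral_kernel [IsMarkovKernel P] {E : Type*} [NormedAddCommGroup E]
    [NormedSpace ℝ E] [MeasurableSpace E] [BorelSpace E] [SecondCountableTopology E]
    {g : S × S × S → E} (hg : Measurable g) : Measurable fun x => ∫ p, g (x, p) ∂(P x) :=
  (StronglyMeasurable.integral_kernel_prod_right' (κ := P) hg.stronglyMeasurable).measurable

theorem measurable_actTri [IsMarkovKernel P] {g : S × S × S → ℝ} (hg : Measurable g) :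
    Measurable (actTri P g) :=
  measurable_integral_kernel hg

theorem norm_integral_kernel_le [IsMarkovKernel P] {E : Type*} [NormedAddCommGroup E]
    [NormedSpace ℝ E] {g : S × S × S → E} {C : ℝ} (hg : ∀ y, ‖g y‖ ≤ C) (x : S) :
    ‖∫ p, g (x, p) ∂(P x)‖ ≤ C := by
  simpa using norm_integral_le_of_norm_le_const (μ := P x) (f := fun p => g (x, p)) (C := C)
    (ae_of_all _ fun p => hg _)

theorem integrable_of_forall_norm_le [IsFiniteMeasure mP] {E : Type*} [NormedAddCommGroup E]
    [MeasurableSpace E] [BorelSpace E] [SecondCountableTopology E] {f : Ω → E}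
    (hf : Measurable f) {C : ℝ} (hC : ∀ ω, ‖f ω‖ ≤ C) : Integrable f mP :=
  Integrable.of_bound hf.aestronglyMeasurable C (ae_of_all _ hC)

theorem norm_prod_le_prod_const {ι 𝕜 : Type*} [NormedField 𝕜] (s : Finset ι) {a : ι → 𝕜}
    {C : ι → ℝ} (h : ∀ i ∈ s, ‖a i‖ ≤ C i) : ‖∏ i ∈ s, a i‖ ≤ ∏ i ∈ s, C i := by
  rw [norm_prod]
  exact Finset.prod_le_prod (fun _ _ => norm_nonneg _) h

/-- The factor `z` is known at generation `k`, so it can be pulled through the conditional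
expectation. -/
theorem IsBMC.integral_mul_prod [IsProbabilityMeasure mP] (hX : IsBMC mP ν P X) (k : ℕ) {z : Ω → ℝ}
    (hz : Measurable[sigmaUpTo X k] z) {C : ℝ} (hzC : ∀ ω, |z ω| ≤ C)
    {g : List Bool → S × S × S → ℝ} (hg : ∀ u, Measurable (g u))
    (hgb : ∀ u, ∃ C, ∀ y, |g u y| ≤ C) :
    ∫ ω, z ω * ∏ u ∈ gen k, g u (triangle X u ω) ∂mP =
      ∫ ω, z ω * ∏ u ∈ gen k, actTri P (g u) (X u ω) ∂mP := by
  have hm := hX.sigmaUpTo_le k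
  choose D hD using hgb
  have hYm : Measurable fun ω => ∏ u ∈ gen k, g u (triangle X u ω) :=
    Finset.measurable_fun_prod _ fun u _ => (hg u).comp (hX.measurable_triangle u)
  have hYi : Integrable (fun ω => ∏ u ∈ gen k, g u (triangle X u ω)) mP :=
    integrable_of_forall_norm_le hYm fun ω => norm_prod_le_prod_const _ fun u _ => hD u _
  have hzY : Integrable (z * fun ω => ∏ u ∈ gen k, g u (triangle X u ω)) mP :=
    hYi.bdd_mul (hz.mono hm le_rfl).aestronglyMeasurable (ae_of_all _ hzC)
  have h1 := condExp_mul_of_stronglyMeasurable_left (μ := mP) hz.stronglyMeasurable hzY hYi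
  have h2 := hX.branching g hg (fun u => ⟨D u, hD u⟩) k
  calc ∫ ω, z ω * ∏ u ∈ gen k, g u (triangle X u ω) ∂mP
      = ∫ ω, (mP[z * fun ω => ∏ u ∈ gen k, g u (triangle X u ω) | sigmaUpTo X k]) ω ∂mP :=
        (integral_condExp hm).symm
    _ = _ := by
        refine integral_congr_ae ?_
        filter_upwards [h1, h2] with ω e1 e2
        rw [e1, Pi.mul_apply, e2]

theorem integral_complex_mul_eq [IsFiniteMeasure mP] {z : Ω → ℂ} (hz : Measurable z) {C : ℝ}
    (hzC : ∀ ω, ‖z ω‖ ≤ C) {a b : Ω → ℝ} (ha : Integrable a mP) (hb : Integrable b mP)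
    (hre : ∫ ω, (z ω).re * a ω ∂mP = ∫ ω, (z ω).re * b ω ∂mP)
    (him : ∫ ω, (z ω).im * a ω ∂mP = ∫ ω, (z ω).im * b ω ∂mP) :
    ∫ ω, z ω * (a ω : ℂ) ∂mP = ∫ ω, z ω * (b ω : ℂ) ∂mP := by
  have key : ∀ a : Ω → ℝ, Integrable a mP → ∫ ω, z ω * (a ω : ℂ) ∂mP =
      ((∫ ω, (z ω).re * a ω ∂mP : ℝ) : ℂ) + ((∫ ω, (z ω).im * a ω ∂mP : ℝ) : ℂ) * Complex.I := by
    intro a ha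
    have hi : Integrable (fun ω => z ω * (a ω : ℂ)) mP :=
      ha.ofReal.bdd_mul hz.aestronglyMeasurable (ae_of_all _ hzC)
    have := integral_re_add_im hi
    simpa using this.symm
  rw [key a ha, key b hb, hre, him]

/-- The branching property for complex test functions. -/
theorem IsBMC.integral_mul_prod_complex [IsProbabilityMeasure mP] [IsMarkovKernel P]
    (hX : IsBMC mP ν P X) (k : ℕ) {z : Ω → ℂ}
    (hz : Measurable[sigmaUpTo X k] z) {C : ℝ} (hzC : ∀ ω, ‖z ω‖ ≤ C)
    {g : List Bool → S × S × S → ℂ} (hg : ∀ u, Measurable (g u)) {D : ℝ}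
    (hgb : ∀ u y, ‖g u y‖ ≤ D) :
    ∫ ω, z ω * ∏ u ∈ gen k, g u (triangle X u ω) ∂mP =
      ∫ ω, z ω * ∏ u ∈ gen k, ∫ p, g u (X u ω, p) ∂(P (X u ω)) ∂mP := by
  classical
  have hm := hX.sigmaUpTo_le k
  -- Multiplying out `∏ (re + i im)` over subsets `t` gives real products, with the real part at `u
  -- ∈ t` and the imaginary part elsewhere; the real branching property applies to each.
  let c : Finset (List Bool) → List Bool → S × S × S → ℝ :=
    fun t u y => if u ∈ t then (g u y).re else (g u y).im
  have hcm : ∀ t u, Measurable (c t u) := by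
    intro t u
    by_cases h : u ∈ t
    · simpa [c, h, Function.comp_def] using Complex.measurable_re.comp (hg u)
    · simpa [c, h, Function.comp_def] using Complex.measurable_im.comp (hg u)
  have hcb : ∀ t u y, |c t u y| ≤ D := by
    intro t u y
    by_cases h : u ∈ t
    · simpa [c, h] using (Complex.abs_re_le_norm _).trans (hgb u y)
    · simpa [c, h] using (Complex.abs_im_le_norm _).trans (hgb u y)
  have expand : ∀ a b : List Bool → ℝ, ∏ u ∈ gen k, ((a u : ℂ) + b u * Complex.I) =
      ∑ t ∈ (gen k).powerset, Complex.I ^ (gen k \ t).card *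
        ((∏ u ∈ gen k, if u ∈ t then a u else b u : ℝ) : ℂ) := by
    intro a b
    rw [Finset.prod_add]
    refine Finset.sum_congr rfl fun t ht => ?_
    rw [Finset.prod_mul_distrib, Finset.prod_const, Finset.prod_ite, Complex.ofReal_mul,
      Complex.ofReal_prod, Complex.ofReal_prod, Finset.filter_mem_eq_inter,
      Finset.inter_eq_right.2 (Finset.mem_powerset.1 ht), ← Finset.sdiff_eq_filter]
    ring
  have e1 : ∀ ω, ∏ u ∈ gen k, g u (triangle X u ω) = ∑ t ∈ (gen k).powerset,
      Complex.I ^ (gen k \ t).card * ((∏ u ∈ gen k, c t u (triangle X u ω) : ℝ) : ℂ) := by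
    intro ω
    rw [← expand]
    exact Finset.prod_congr rfl fun u _ => (Complex.re_add_im _).symm
  have e2 : ∀ ω, ∏ u ∈ gen k, ∫ p, g u (X u ω, p) ∂(P (X u ω)) = ∑ t ∈ (gen k).powerset,
      Complex.I ^ (gen k \ t).card * ((∏ u ∈ gen k, actTri P (c t u) (X u ω) : ℝ) : ℂ) := by
    intro ω
    have : ∀ t u, actTri P (c t u) (X u ω) = if u ∈ t then ∫ p, (g u (X u ω, p)).re ∂(P (X u ω))
        else ∫ p, (g u (X u ω, p)).im ∂(P (X u ω)) := by
      intro t u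
      by_cases h : u ∈ t <;> simp [actTri, c, h]
    simp only [this]
    rw [← expand]
    refine Finset.prod_congr rfl fun u _ => ?_
    have hi : Integrable (fun p => g u (X u ω, p)) (P (X u ω)) :=
      integrable_of_forall_norm_le ((hg u).comp (by fun_prop)) fun p => hgb u _
    simpa using (integral_re_add_im hi).symm
  have hzm := hz.mono hm le_rfl
  have i1 : ∀ t, Integrable (fun ω => ∏ u ∈ gen k, c t u (triangle X u ω)) mP := fun t =>
    integrable_of_forall_norm_le (Finset.measurable_fun_prod _ fun u _ =>
      (hcm t u).comp (hX.measurable_triangle u)) fun ω => norm_prod_le_prod_const _ fun u _ => hcb t u _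
  have i2 : ∀ t, Integrable (fun ω => ∏ u ∈ gen k, actTri P (c t u) (X u ω)) mP := fun t =>
    integrable_of_forall_norm_le (Finset.measurable_fun_prod _ fun u _ =>
      (measurable_actTri (hcm t u)).comp (hX.measurable u)) fun ω =>
        norm_prod_le_prod_const _ fun u _ => norm_integral_kernel_le (hcb t u) _
  simp only [e1, e2, Finset.mul_sum, mul_left_comm (z _)]
  rw [integral_finsetSum, integral_finsetSum]
  · refine Finset.sum_congr rfl fun t _ => ?_
    rw [integral_const_mul, integral_const_mul]
    congr 1
    refine integral_complex_mul_eq hzm hzC (i1 t) (i2 t) ?_ ?_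
    · exact hX.integral_mul_prod k (Complex.measurable_re.comp hz)
        (fun ω => (Complex.abs_re_le_norm _).trans (hzC ω)) (hcm t) fun u => ⟨D, hcb t u⟩
    · exact hX.integral_mul_prod k (Complex.measurable_im.comp hz)
        (fun ω => (Complex.abs_im_le_norm _).trans (hzC ω)) (hcm t) fun u => ⟨D, hcb t u⟩
  · exact fun t _ => ((i2 t).ofReal.bdd_mul hzm.aestronglyMeasurable (ae_of_all _ hzC)).const_mul _
  · exact fun t _ => ((i1 t).ofReal.bdd_mul hzm.aestronglyMeasurable (ae_of_all _ hzC)).const_mul _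

end Branching

/-! ### Unbounded test functions and pairs of triangles -/

section Moments

variable {S : Type*} [MeasurableSpace S] {Ω : Type*} [MeasurableSpace Ω]
  {mP : Measure Ω} {ν : Measure S} {P : Kernel S (S × S)} {X : List Bool → Ω → S}

theorem sum_gen_succ {M : Type*} [AddCommMonoid M] (k : ℕ) (φ : List Bool → M) :
    ∑ u ∈ gen (k + 1), φ u = ∑ u ∈ gen k, (φ (u ++ [false]) + φ (u ++ [true])) := by
  classical
  have hinj : ∀ b : Bool, Function.Injective fun u : List Bool => u ++ [b] :=
    fun b => List.append_left_injective [b]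
  have hdis : Disjoint ((gen k).image fun u => u ++ [false])
      ((gen k).image fun u => u ++ [true]) := by
    rw [Finset.disjoint_left]
    intro v h1 h2
    obtain ⟨a, -, rfl⟩ := Finset.mem_image.1 h1
    obtain ⟨b, -, hb⟩ := Finset.mem_image.1 h2
    simpa using congrArg List.getLast? hb
  have hgen : gen (k + 1) = ((gen k).image fun u => u ++ [false]) ∪
      ((gen k).image fun u => u ++ [true]) := by
    ext v
    simp only [mem_gen, Finset.mem_union, Finset.mem_image]
    constructor
    · intro hv
      have hne : v ≠ [] := by
        rintro rfl
        simp at hv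
      have hlen : v.dropLast.length = k := by simp [hv]
      have hv' := List.dropLast_append_getLast hne
      cases hb : v.getLast hne
      · exact Or.inl ⟨v.dropLast, hlen, by rw [← hb]; exact hv'⟩
      · exact Or.inr ⟨v.dropLast, hlen, by rw [← hb]; exact hv'⟩
    · rintro (⟨u, rfl, rfl⟩ | ⟨u, rfl, rfl⟩) <;> simp
  rw [hgen, Finset.sum_union hdis, Finset.sum_image fun _ _ _ _ h => hinj _ h,
    Finset.sum_image fun _ _ _ _ h => hinj _ h, Finset.sum_add_distrib]

theorem sum_gen_zero {M : Type*} [AddCommMonoid M] (φ : List Bool → M) :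
    ∑ u ∈ gen 0, φ u = φ [] := by
  have : gen 0 = {[]} := by
    ext v
    simp [mem_gen]
  rw [this, Finset.sum_singleton]

variable [IsProbabilityMeasure mP] [IsMarkovKernel P]

/-- Test functions equal to 1 outside `s` are left unchanged by the kernel, so the other vertices
drop out. -/
theorem IsBMC.integral_prod_subset (hX : IsBMC mP ν P X) {k : ℕ} {s : Finset (List Bool)}
    (hs : s ⊆ gen k) {g : S × S × S → ℝ} (hg : Measurable g) {C : ℝ} (hC : ∀ y, |g y| ≤ C) :
    ∫ ω, ∏ u ∈ s, g (triangle X u ω) ∂mP = ∫ ω, ∏ u ∈ s, actTri P g (X u ω) ∂mP := by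
  classical
  have h := hX.integral_mul_prod k (z := fun _ => 1) (C := 1) measurable_const (by simp)
    (g := fun u => if u ∈ s then g else fun _ => 1)
    (fun u => by split_ifs; exacts [hg, measurable_const])
    (fun u => by
      split_ifs
      · exact ⟨C, hC⟩
      · exact ⟨1, by simp⟩)
  simp only [one_mul] at h
  convert h using 2
  · funext ω
    rw [← Finset.prod_subset hs fun u _ hu => by simp [hu]]
    exact Finset.prod_congr rfl fun u hu => by simp [hu]
  · funext ω
    rw [← Finset.prod_subset hs fun u _ hu => by simp [hu, actTri]]
    exact Finset.prod_congr rfl fun u hu => by simp [hu]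

/-- Branching tested on indicators at a single vertex identifies the law of a triangle, which gives
access to Fubini for unbounded functions. -/
theorem IsBMC.map_triangle (hX : IsBMC mP ν P X) (u : List Bool) :
    mP.map (triangle X u) = (mP.map (X u)) ⊗ₘ P := by
  ext s hs
  have hpX : IsProbabilityMeasure (mP.map (X u)) :=
    Measure.isProbabilityMeasure_map (hX.measurable u).aemeasurable
  have hpt : IsProbabilityMeasure (mP.map (triangle X u)) :=
    Measure.isProbabilityMeasure_map (hX.measurable_triangle u).aemeasurable
  have hg : Measurable (s.indicator fun _ => (1 : ℝ)) := measurable_const.indicator hs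
  have hb : ∀ y, ‖s.indicator (fun _ => (1 : ℝ)) y‖ ≤ 1 := fun y =>
    (norm_indicator_le_norm_self _ _).trans (by simp)
  have h := hX.integral_prod_subset (k := u.length) (s := {u})
    (by simp [mem_gen]) hg (C := 1) hb
  simp only [Finset.prod_singleton] at h
  rw [← integral_map (hX.measurable_triangle u).aemeasurable hg.aestronglyMeasurable,
    ← integral_map (hX.measurable u).aemeasurable (measurable_actTri hg).aestronglyMeasurable]
    at h
  have h' : ∫ x, actTri P (s.indicator fun _ => (1 : ℝ)) x ∂(mP.map (X u)) =
      ∫ y, s.indicator (fun _ => (1 : ℝ)) y ∂((mP.map (X u)) ⊗ₘ P) :=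
    (Measure.integral_compProd (integrable_of_forall_norm_le hg hb)).symm
  rw [h', integral_indicator_const _ hs, integral_indicator_const _ hs] at h
  simpa using (measureReal_eq_measureReal_iff).1 (by simpa using h)

theorem IsBMC.integrable_triangle (hX : IsBMC mP ν P X) {u : List Bool} {G : S × S × S → ℝ}
    (hG : Measurable G) (h0 : ∀ y, 0 ≤ G y)
    (hi : ∀ x, Integrable (fun p : S × S => G (x, p.1, p.2)) (P x))
    (hu : Integrable (fun ω => actTri P G (X u ω)) mP) :
    Integrable (fun ω => G (triangle X u ω)) mP := by
  have hpX : IsProbabilityMeasure (mP.map (X u)) :=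
    Measure.isProbabilityMeasure_map (hX.measurable u).aemeasurable
  refine (integrable_map_measure (g := G) hG.aestronglyMeasurable
    (hX.measurable_triangle u).aemeasurable).1 ?_
  rw [hX.map_triangle, Measure.integrable_compProd_iff hG.aestronglyMeasurable]
  refine ⟨ae_of_all _ hi, ?_⟩
  refine Integrable.congr ((integrable_map_measure (measurable_actTri hG).aestronglyMeasurable
    (hX.measurable u).aemeasurable).2 hu) (ae_of_all _ fun x => ?_)
  exact integral_congr_ae (ae_of_all _ fun p => by simp [abs_of_nonneg (h0 _)])

theorem IsBMC.integral_triangle (hX : IsBMC mP ν P X) {u : List Bool} {G : S × S × S → ℝ}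
    (hG : Measurable G) (hu : Integrable (fun ω => G (triangle X u ω)) mP) :
    ∫ ω, G (triangle X u ω) ∂mP = ∫ ω, actTri P G (X u ω) ∂mP := by
  have hpX : IsProbabilityMeasure (mP.map (X u)) :=
    Measure.isProbabilityMeasure_map (hX.measurable u).aemeasurable
  rw [← integral_map (hX.measurable_triangle u).aemeasurable hG.aestronglyMeasurable,
    ← integral_map (hX.measurable u).aemeasurable (measurable_actTri hG).aestronglyMeasurable,
    hX.map_triangle, Measure.integral_compProd]
  · rfl
  · rw [← hX.map_triangle]
    exact (integrable_map_measure hG.aestronglyMeasurable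
      (hX.measurable_triangle u).aemeasurable).2 hu

theorem sq_actTri_le {G : S × S × S → ℝ} (hG : Measurable G) {x : S}
    (hi : Integrable (fun p : S × S => G (x, p.1, p.2) ^ 2) (P x)) :
    actTri P G x ^ 2 ≤ actTri P (fun y => G y ^ 2) x := by
  have hvar := variance_nonneg (fun p : S × S => G (x, p.1, p.2)) (P x)
  have hm : Measurable fun p : S × S => G (x, p.1, p.2) := hG.comp (by fun_prop)
  rw [variance_eq_sub ((memLp_two_iff_integrable_sq hm.aestronglyMeasurable).2 hi)] at hvar
  exact sub_nonneg.1 hvar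

/-- Distinct triangles of one generation are conditionally independent. -/
theorem IsBMC.integral_triangle_mul_triangle (hX : IsBMC mP ν P X) {k : ℕ} {u v : List Bool}
    (hu : u ∈ gen k) (hv : v ∈ gen k) (huv : u ≠ v) {G : S × S × S → ℝ} (hG : Measurable G)
    (hG1 : ∀ x, Integrable (fun p : S × S => G (x, p.1, p.2)) (P x))
    (hG2 : ∀ x, Integrable (fun p : S × S => G (x, p.1, p.2) ^ 2) (P x))
    (hiu : Integrable (fun ω => actTri P (fun y => G y ^ 2) (X u ω)) mP)
    (hiv : Integrable (fun ω => actTri P (fun y => G y ^ 2) (X v ω)) mP) :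
    ∫ ω, G (triangle X u ω) * G (triangle X v ω) ∂mP =
      ∫ ω, actTri P G (X u ω) * actTri P G (X v ω) ∂mP := by
  classical
  -- Branching is available only for bounded functions: `G` is truncated at level `N`, and both
  -- sides pass to the limit by dominated convergence.
  let T : ℕ → S × S × S → ℝ := fun N y => max (-(N : ℝ)) (min N (G y))
  have hTm : ∀ N, Measurable (T N) := fun N => measurable_const.max (measurable_const.min hG)
  have hTN : ∀ N y, |T N y| ≤ N := by
    intro N y
    have : (0 : ℝ) ≤ N := N.cast_nonneg
    exact abs_le.2 ⟨le_max_left _ _, max_le (by linarith) (min_le_left _ _)⟩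
  have hTG : ∀ N y, |T N y| ≤ |G y| := by
    intro N y
    have : (0 : ℝ) ≤ N := N.cast_nonneg
    simp only [T]
    rcases max_cases (-(N : ℝ)) (min N (G y)) with ⟨h1, h2⟩ | ⟨h1, h2⟩ <;>
      rcases min_cases (N : ℝ) (G y) with ⟨h3, h4⟩ | ⟨h3, h4⟩ <;> rw [h1] <;>
      rcases abs_cases (G y) with ⟨h5, h6⟩ | ⟨h5, h6⟩ <;>
      first
        | (rw [abs_neg, abs_of_nonneg this]; linarith)
        | (rw [h3, abs_of_nonneg this]; linarith)
        | (rw [h3])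
  have hTlim : ∀ y, Tendsto (fun N => T N y) atTop (nhds (G y)) := by
    intro y
    obtain ⟨N, hN⟩ := exists_nat_ge |G y|
    refine tendsto_const_nhds.congr' ?_
    filter_upwards [eventually_ge_atTop N] with M hM
    have hM' : |G y| ≤ M := hN.trans (by exact_mod_cast hM)
    simp only [T]
    rw [min_eq_right ((abs_le.1 hM').2), max_eq_right (abs_le.1 hM').1]
  have hPT : ∀ x, Tendsto (fun N => actTri P (T N) x) atTop (nhds (actTri P G x)) := by
    intro x
    refine tendsto_integral_of_dominated_convergence (fun p => |G (x, p.1, p.2)|)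
      (fun N => ((hTm N).comp (by fun_prop)).aestronglyMeasurable) (hG1 x).abs
      (fun N => ae_of_all _ fun p => hTG N _) (ae_of_all _ fun p => hTlim _)
  have hsq : Measurable fun y => G y ^ 2 := hG.pow_const 2
  have hPT2 : ∀ N x, (actTri P (T N) x) ^ 2 ≤ actTri P (fun y => G y ^ 2) x := by
    intro N x
    have hT2 : ∀ y, T N y ^ 2 ≤ G y ^ 2 := fun y => sq_le_sq.2 (hTG N y)
    have hTi2 : Integrable (fun p : S × S => T N (x, p.1, p.2) ^ 2) (P x) :=
      (hG2 x).mono' (((hTm N).pow_const 2).comp (by fun_prop)).aestronglyMeasurable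
        (ae_of_all _ fun p => by
          rw [Real.norm_eq_abs, abs_of_nonneg (sq_nonneg _)]
          exact hT2 _)
    exact (sq_actTri_le (hTm N) hTi2).trans (integral_mono hTi2 (hG2 x) fun p => hT2 _)
  have hGu := hX.integrable_triangle (u := u) hsq (fun _ => sq_nonneg _) hG2 hiu
  have hGv := hX.integrable_triangle (u := v) hsq (fun _ => sq_nonneg _) hG2 hiv
  -- The domination for both limits: `|ab| ≤ a² + b²`, with squares bounded by `G²`, respectively by
  -- `P(G²)`, uniformly in `N`.
  have hbd : ∀ a b A B : ℝ, a ^ 2 ≤ A → b ^ 2 ≤ B → ‖a * b‖ ≤ A + B := by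
    intro a b A B h1 h2
    rw [Real.norm_eq_abs, abs_le]
    constructor <;> nlinarith [sq_nonneg (a + b), sq_nonneg (a - b), sq_nonneg a, sq_nonneg b]
  have hT2 : ∀ N y, T N y ^ 2 ≤ G y ^ 2 := fun N y => sq_le_sq.2 (hTG N y)
  have l1 : Tendsto (fun N => ∫ ω, T N (triangle X u ω) * T N (triangle X v ω) ∂mP) atTop
      (nhds (∫ ω, G (triangle X u ω) * G (triangle X v ω) ∂mP)) :=
    tendsto_integral_of_dominated_convergence _
      (fun N => (((hTm N).comp (hX.measurable_triangle u)).mul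
        ((hTm N).comp (hX.measurable_triangle v))).aestronglyMeasurable) (hGu.add hGv)
      (fun N => ae_of_all _ fun ω => hbd _ _ _ _ (hT2 N _) (hT2 N _))
      (ae_of_all _ fun ω => (hTlim _).mul (hTlim _))
  have l2 : Tendsto (fun N => ∫ ω, actTri P (T N) (X u ω) * actTri P (T N) (X v ω) ∂mP) atTop
      (nhds (∫ ω, actTri P G (X u ω) * actTri P G (X v ω) ∂mP)) :=
    tendsto_integral_of_dominated_convergence _
      (fun N => (((measurable_actTri (hTm N)).comp (hX.measurable u)).mul
        ((measurable_actTri (hTm N)).comp (hX.measurable v))).aestronglyMeasurable) (hiu.add hiv)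
      (fun N => ae_of_all _ fun ω => hbd _ _ _ _ (hPT2 N _) (hPT2 N _))
      (ae_of_all _ fun ω => (hPT _).mul (hPT _))
  refine tendsto_nhds_unique l1 (l2.congr fun N => ?_)
  have h := hX.integral_prod_subset (k := k) (s := {u, v})
    (by simp [Finset.insert_subset_iff, hu, hv]) (hTm N) (hTN N)
  simpa only [Finset.prod_pair huv] using h.symm

end Moments

/-- Since `F` contains the constants, tensoring with 1 turns the hypotheses on `f ⊗ g` into
statements about the two marginals of `P`. -/
theorem tensor_const_one {S : Type*} (h : S → ℝ) : tensor h (fun _ => 1) = fun p => h p.1 := by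
  funext p
  simp [tensor]

theorem const_one_tensor {S : Type*} (h : S → ℝ) : tensor (fun _ => 1) h = fun p => h p.2 := by
  funext p
  simp [tensor]

/-! ### Stability of `F` and second moments over a generation -/

section FunctionSpace

variable {S : Type*} [MeasurableSpace S] {ν : Measure S} {P : Kernel S (S × S)}
  {F : Submodule ℝ (S → ℝ)} {h : S → ℝ}

theorem Structural.integrable_fst (hF : Structural ν P F) (hh : h ∈ F) (x : S) :
    Integrable (fun p : S × S => h p.1) (P x) :=
  tensor_const_one h ▸ hF.tensor_integrable h hh _ (hF.const_mem 1) x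

theorem Structural.integrable_snd (hF : Structural ν P F) (hh : h ∈ F) (x : S) :
    Integrable (fun p : S × S => h p.2) (P x) :=
  const_one_tensor h ▸ hF.tensor_integrable _ (hF.const_mem 1) h hh x

theorem Structural.actTri_fst_mem (hF : Structural ν P F) (hh : h ∈ F) :
    actTri P (fun y => h y.2.1) ∈ F := by
  have := hF.tensor_mem h hh _ (hF.const_mem 1)
  rwa [tensor_const_one] at this

theorem Structural.actTri_snd_mem (hF : Structural ν P F) (hh : h ∈ F) :
    actTri P (fun y => h y.2.2) ∈ F := by
  have := hF.tensor_mem _ (hF.const_mem 1) h hh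
  rwa [const_one_tensor] at this

theorem Structural.integrable_meanKernel (hF : Structural ν P F) (hh : h ∈ F) (x : S) :
    Integrable h (meanKernel P x) := by
  have hm : ∀ κ : Measure S, AEStronglyMeasurable h κ :=
    fun κ => (hF.measurable h hh).aestronglyMeasurable
  change Integrable h ((2⁻¹ : ℝ≥0∞) • ((P.fst + P.snd) x))
  rw [add_apply]
  refine Integrable.smul_measure (Integrable.add_measure ?_ ?_) (by simp)
  · rw [Kernel.fst_apply]
    exact (integrable_map_measure (hm _) measurable_fst.aemeasurable).2 (hF.integrable_fst hh x)
  · rw [Kernel.snd_apply]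
    exact (integrable_map_measure (hm _) measurable_snd.aemeasurable).2 (hF.integrable_snd hh x)

theorem Structural.actQ_eq (hF : Structural ν P F) (hh : h ∈ F) (x : S) :
    actQ P h x = 2⁻¹ * (actTri P (fun y => h y.2.1) x + actTri P (fun y => h y.2.2) x) := by
  have hm : ∀ κ : Measure S, AEStronglyMeasurable h κ :=
    fun κ => (hF.measurable h hh).aestronglyMeasurable
  change ∫ y, h y ∂((2⁻¹ : ℝ≥0∞) • ((P.fst + P.snd) x)) = _
  rw [add_apply, integral_smul_measure, integral_add_measure, Kernel.fst_apply, Kernel.snd_apply,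
    integral_map measurable_fst.aemeasurable (hm _),
    integral_map measurable_snd.aemeasurable (hm _)]
  · simp [actTri]
  · rw [Kernel.fst_apply]
    exact (integrable_map_measure (hm _) measurable_fst.aemeasurable).2 (hF.integrable_fst hh x)
  · rw [Kernel.snd_apply]
    exact (integrable_map_measure (hm _) measurable_snd.aemeasurable).2 (hF.integrable_snd hh x)

theorem Structural.actTri_add (hF : Structural ν P F) (hh : h ∈ F) (x : S) :
    actTri P (fun y => h y.2.1 + h y.2.2) x = 2 * actQ P h x := by
  rw [hF.actQ_eq hh, actTri, integral_add (hF.integrable_fst hh x) (hF.integrable_snd hh x)]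
  simp [actTri]

theorem Structural.actQ_mem (hF : Structural ν P F) (hh : h ∈ F) : actQ P h ∈ F := by
  have := F.smul_mem (2⁻¹ : ℝ) (F.add_mem (hF.actTri_fst_mem hh) (hF.actTri_snd_mem hh))
  convert this using 1
  funext x
  simp [hF.actQ_eq hh]

theorem Structural.iterQ_mem (hF : Structural ν P F) (hh : h ∈ F) (n : ℕ) : iterQ P n h ∈ F := by
  induction n generalizing h with
  | zero => exact hh
  | succ n ih => exact ih (hF.actQ_mem hh)

theorem Structural.iterQ_sub_const [IsMarkovKernel P] (hF : Structural ν P F) (hh : h ∈ F) (c : ℝ)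
    (n : ℕ) (x : S) : iterQ P n (fun y => h y - c) x = iterQ P n h x - c := by
  induction n generalizing h with
  | zero => rfl
  | succ n ih =>
    have : actQ P (fun y => h y - c) = fun y => actQ P h y - c := by
      funext y
      rw [actQ, integral_sub (hF.integrable_meanKernel hh y) (integrable_const c)]
      simp [actQ]
    change iterQ P n (actQ P fun y => h y - c) x = iterQ P n (actQ P h) x - c
    rw [this, ih (hF.actQ_mem hh)]

theorem Structural.integrable_sq_add (hF : Structural ν P F) (hh : h ∈ F) (x : S) :
    Integrable (fun p : S × S => (h p.1 + h p.2) ^ 2) (P x) := by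
  have := ((hF.integrable_fst (hF.sq_mem h hh) x).add
    (hF.integrable_snd (hF.sq_mem h hh) x)).add ((hF.tensor_integrable h hh h hh x).const_mul 2)
  refine this.congr (ae_of_all _ fun p => ?_)
  simp only [Pi.add_apply, tensor]
  ring

/-- Expanding the square leaves two squares and a tensor product, each covered by a closure property
of `F`. -/
theorem Structural.actTri_sq_add_mem (hF : Structural ν P F) (hh : h ∈ F) :
    actTri P (fun y => (h y.2.1 + h y.2.2) ^ 2) ∈ F := by
  have hs := hF.sq_mem h hh
  have := F.add_mem (F.add_mem (hF.actTri_fst_mem hs) (hF.actTri_snd_mem hs))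
    (F.smul_mem (2 : ℝ) (hF.tensor_mem h hh h hh))
  convert this using 1
  funext x
  have e : ∀ p : S × S, (h p.1 + h p.2) ^ 2 = (h p.1 ^ 2 + h p.2 ^ 2) + 2 * tensor h h p := by
    intro p
    simp only [tensor]
    ring
  simp only [actTri, e, Pi.add_apply, Pi.smul_apply, smul_eq_mul, actPair]
  rw [integral_add (f := fun p : S × S => h p.1 ^ 2 + h p.2 ^ 2)
    ((hF.integrable_fst hs x).add (hF.integrable_snd hs x))
    ((hF.tensor_integrable h hh h hh x).const_mul 2),
    integral_add (hF.integrable_fst hs x) (hF.integrable_snd hs x), integral_const_mul]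

variable {Ω : Type*} [MeasurableSpace Ω] {mP : Measure Ω} {X : List Bool → Ω → S}
  [IsProbabilityMeasure mP] [IsMarkovKernel P]

/-- Induction along the path to `u`, with `h` varying: the kernel sends `h²` at a daughter to an
element of `F` at the mother. Squares supply the nonnegativity needed there, and `|h| ≤ h² + 1`
returns to `h`. -/
theorem IsBMC.integrable_comp (hX : IsBMC mP ν P X) (hF : Structural ν P F) (hh : h ∈ F)
    (u : List Bool) : Integrable (fun ω => h (X u ω)) mP := by
  induction u using List.reverseRecOn generalizing h with
  | nil =>
    have := hF.integrable h hh
    rw [← hX.initial] at this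
    exact (integrable_map_measure (hF.measurable h hh).aestronglyMeasurable
      (hX.measurable _).aemeasurable).1 this
  | append_singleton u b ih =>
    have hs := hF.sq_mem h hh
    have hm := hF.measurable h hh
    have key : Integrable (fun ω => h (X (u ++ [b]) ω) ^ 2) mP := by
      cases b
      · exact hX.integrable_triangle (u := u) (G := fun y => h y.2.1 ^ 2) (by fun_prop)
          (fun _ => sq_nonneg _) (hF.integrable_fst hs) (ih (hF.actTri_fst_mem hs))
      · exact hX.integrable_triangle (u := u) (G := fun y => h y.2.2 ^ 2) (by fun_prop)
          (fun _ => sq_nonneg _) (hF.integrable_snd hs) (ih (hF.actTri_snd_mem hs))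
    refine (key.add (integrable_const (1 : ℝ))).mono'
      (hm.comp (hX.measurable _)).aestronglyMeasurable (ae_of_all _ fun ω => ?_)
    rw [Real.norm_eq_abs, Pi.add_apply, ← sq_abs]
    nlinarith [sq_nonneg (|h (X (u ++ [b]) ω)| - 1), abs_nonneg (h (X (u ++ [b]) ω))]

/-- The many-to-one formula. -/
theorem IsBMC.sum_integral_comp (hX : IsBMC mP ν P X) (hF : Structural ν P F) (hh : h ∈ F)
    (k : ℕ) : ∑ u ∈ gen k, ∫ ω, h (X u ω) ∂mP = 2 ^ k * ∫ x, iterQ P k h x ∂ν := by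
  induction k generalizing h with
  | zero =>
    rw [sum_gen_zero, ← hX.initial, integral_map (hX.measurable _).aemeasurable
      (hF.measurable _ (hF.iterQ_mem hh 0)).aestronglyMeasurable]
    simp [iterQ]
  | succ k ih =>
    have hm := hF.measurable h hh
    have e : ∀ u, ∫ ω, h (X (u ++ [false]) ω) ∂mP + ∫ ω, h (X (u ++ [true]) ω) ∂mP =
        2 * ∫ ω, actQ P h (X u ω) ∂mP := by
      intro u
      have i0 := hX.integrable_comp hF hh (u ++ [false])
      have i1 := hX.integrable_comp hF hh (u ++ [true])
      rw [← integral_add i0 i1, ← integral_const_mul]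
      simp_rw [← hF.actTri_add hh]
      exact hX.integral_triangle (G := fun y => h y.2.1 + h y.2.2) (by fun_prop) (i0.add i1)
    rw [sum_gen_succ, Finset.sum_congr rfl fun u _ => e u, ← Finset.mul_sum, ih (hF.actQ_mem hh)]
    change _ = 2 ^ (k + 1) * ∫ x, iterQ P k (actQ P h) x ∂ν
    ring

/-- By the many-to-one formula it suffices that `Q^k h ≤ |⟨μ, h⟩| + g` uniformly in `k`, with `g`
integrable under `ν`. -/
theorem IsBMC.exists_sum_integral_le (hX : IsBMC mP ν P X) [IsProbabilityMeasure ν]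
    (hF : Structural ν P F) {μ : Measure S}
    {α : ℝ} (hα : α ∈ Set.Ioo (0 : ℝ) 1) (hμ : GeomErgodic P F μ α) (hh : h ∈ F) :
    ∃ C, 0 ≤ C ∧ ∀ k, ∑ u ∈ gen k, ∫ ω, h (X u ω) ∂mP ≤ 2 ^ k * C := by
  obtain ⟨g, hg, hb⟩ := hμ.bound h hh
  have hg0 : ∀ x, 0 ≤ g x := fun x => by simpa using (abs_nonneg _).trans (hb 0 x)
  refine ⟨|∫ y, h y ∂μ| + ∫ x, g x ∂ν, add_nonneg (abs_nonneg _) (integral_nonneg hg0),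
    fun k => ?_⟩
  rw [hX.sum_integral_comp hF hh]
  refine mul_le_mul_of_nonneg_left ?_ (by positivity)
  have : ∫ x, iterQ P k h x ∂ν ≤ ∫ x, (|∫ y, h y ∂μ| + g x) ∂ν := by
    refine integral_mono (hF.integrable _ (hF.iterQ_mem hh k))
      ((integrable_const _).add (hF.integrable g hg)) fun x => ?_
    have h1 := (abs_le.1 (hb k x)).2
    have h2 : α ^ k * g x ≤ g x := mul_le_of_le_one_left (hg0 x) (pow_le_one₀ hα.1.le hα.2.le)
    have h3 := le_abs_self (∫ y, h y ∂μ)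
    simp only
    linarith
  rw [integral_add (integrable_const _) (hF.integrable g hg)] at this
  simpa using this

/-- In the double sum, conditional independence makes the off-diagonal terms on both sides equal.
Only the diagonal costs the extra `P(G²)` term. -/
theorem IsBMC.integral_sum_sq_le (hX : IsBMC mP ν P X) {k : ℕ} {G : S × S × S → ℝ}
    (hG : Measurable G)
    (hG1 : ∀ x, Integrable (fun p : S × S => G (x, p.1, p.2)) (P x))
    (hG2 : ∀ x, Integrable (fun p : S × S => G (x, p.1, p.2) ^ 2) (P x))
    (hi : ∀ u, Integrable (fun ω => actTri P (fun y => G y ^ 2) (X u ω)) mP) :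
    ∫ ω, (∑ u ∈ gen k, G (triangle X u ω)) ^ 2 ∂mP ≤
      ∫ ω, (∑ u ∈ gen k, actTri P G (X u ω)) ^ 2 ∂mP +
        ∑ u ∈ gen k, ∫ ω, actTri P (fun y => G y ^ 2) (X u ω) ∂mP := by
  classical
  have hsq : Measurable fun y => G y ^ 2 := hG.pow_const 2
  have iG := fun u => hX.integrable_triangle (u := u) hsq (fun _ => sq_nonneg _) hG2 (hi u)
  have LG : ∀ u, MemLp (fun ω => G (triangle X u ω)) 2 mP := fun u =>
    (memLp_two_iff_integrable_sq (hG.comp (hX.measurable_triangle u)).aestronglyMeasurable).2 (iG u)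
  have LP : ∀ u, MemLp (fun ω => actTri P G (X u ω)) 2 mP := fun u => by
    have hm := (measurable_actTri (P := P) hG).comp (hX.measurable u)
    refine (memLp_two_iff_integrable_sq hm.aestronglyMeasurable).2
      ((hi u).mono' (hm.pow_const 2).aestronglyMeasurable (ae_of_all _ fun ω => ?_))
    rw [Real.norm_eq_abs, abs_of_nonneg (sq_nonneg _)]
    exact sq_actTri_le hG (hG2 _)
  have expand : ∀ a : List Bool → Ω → ℝ, (∀ u, MemLp (a u) 2 mP) →
      ∫ ω, (∑ u ∈ gen k, a u ω) ^ 2 ∂mP =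
        ∑ u ∈ gen k, ∑ v ∈ gen k, ∫ ω, a u ω * a v ω ∂mP := by
    intro a ha
    have hi : ∀ u v, Integrable (fun ω => a u ω * a v ω) mP :=
      fun u v => (ha u).integrable_mul (ha v)
    simp_rw [sq, Finset.sum_mul_sum]
    rw [integral_finsetSum _ fun u _ => integrable_finsetSum _ fun v _ => hi u v]
    exact Finset.sum_congr rfl fun u _ => integral_finsetSum _ fun v _ => hi u v
  rw [expand _ LG, expand _ LP, ← Finset.sum_add_distrib]
  refine Finset.sum_le_sum fun u hu => ?_
  have : ∫ ω, actTri P (fun y => G y ^ 2) (X u ω) ∂mP = ∑ v ∈ gen k,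
      if u = v then ∫ ω, actTri P (fun y => G y ^ 2) (X u ω) ∂mP else 0 := by
    rw [Finset.sum_ite_eq, if_pos hu]
  rw [this, ← Finset.sum_add_distrib]
  refine Finset.sum_le_sum fun v hv => ?_
  split_ifs with huv
  · subst huv
    rw [← hX.integral_triangle hsq (iG u)]
    simp_rw [← sq]
    exact le_add_of_nonneg_left (integral_nonneg fun _ => sq_nonneg _)
  · rw [add_zero]
    exact (hX.integral_triangle_mul_triangle hu hv huv hG hG1 hG2 (hi u) (hi v)).le

/-- Grouping daughters by mother gives `G = h(y) + h(z)` with `P G = 2 Q h`, whence the factor 4;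
the factor 2 is `(a + b)² ≤ 2a² + 2b²`. -/
theorem IsBMC.integral_sum_sq_succ_le (hX : IsBMC mP ν P X) (hF : Structural ν P F) (hh : h ∈ F)
    (k : ℕ) :
    ∫ ω, (∑ u ∈ gen (k + 1), h (X u ω)) ^ 2 ∂mP ≤
      4 * ∫ ω, (∑ u ∈ gen k, actQ P h (X u ω)) ^ 2 ∂mP +
        2 * ∑ u ∈ gen (k + 1), ∫ ω, h (X u ω) ^ 2 ∂mP := by
  have hm := hF.measurable h hh
  have hs := hF.sq_mem h hh
  let G : S × S × S → ℝ := fun y => h y.2.1 + h y.2.2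
  have hG : Measurable G := by fun_prop
  have hi : ∀ u, Integrable (fun ω => actTri P (fun y => G y ^ 2) (X u ω)) mP :=
    hX.integrable_comp hF (hF.actTri_sq_add_mem hh)
  have hle := hX.integral_sum_sq_le (k := k) hG
    (fun x => (hF.integrable_fst hh x).add (hF.integrable_snd hh x)) (hF.integrable_sq_add hh) hi
  have e1 : ∀ ω, ∑ u ∈ gen (k + 1), h (X u ω) = ∑ u ∈ gen k, G (triangle X u ω) :=
    fun ω => sum_gen_succ k _
  have e2 : ∀ ω, (∑ u ∈ gen k, actTri P G (X u ω)) ^ 2 =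
      4 * (∑ u ∈ gen k, actQ P h (X u ω)) ^ 2 := by
    intro ω
    simp only [G, hF.actTri_add hh, ← Finset.mul_sum]
    ring
  simp only [e1]
  simp only [e2, integral_const_mul] at hle
  refine hle.trans (add_le_add le_rfl ?_)
  rw [sum_gen_succ, Finset.mul_sum]
  refine Finset.sum_le_sum fun u _ => ?_
  have iG := hX.integrable_triangle (u := u) (hG.pow_const 2) (fun _ => sq_nonneg _)
    (hF.integrable_sq_add hh) (hi u)
  have i0 := hX.integrable_comp hF hs (u ++ [false])
  have i1 := hX.integrable_comp hF hs (u ++ [true])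
  rw [← hX.integral_triangle (hG.pow_const 2) iG, ← integral_add i0 i1, ← integral_const_mul]
  refine integral_mono iG ((i0.add i1).const_mul 2) fun ω => ?_
  simp only [G, triangle]
  nlinarith [sq_nonneg (h (X (u ++ [false]) ω) - h (X (u ++ [true]) ω))]

/-- Passing from `h` to `Q h` replaces `a` by `α a`, so the recursion for the bound reads `K α² ρ^k
+ K (ρ - α²) ρ^k = K ρ^(k+1)`. The choice `ρ = (1 + α)/2` meets `α² < ρ < 1` and `ρ ≥ 1/2` at once,
and `K` is large enough that `C ≤ K (ρ - α²)` and `C ≤ K`. -/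
theorem IsBMC.integral_sum_sq_le_geometric (hX : IsBMC mP ν P X) (hF : Structural ν P F)
    {α : ℝ} (hα : α ∈ Set.Ioo (0 : ℝ) 1) {g : S → ℝ} (hg : g ∈ F) {C : ℝ} (hC0 : 0 ≤ C)
    (hC : ∀ k, ∑ u ∈ gen k, ∫ ω, g (X u ω) ^ 2 ∂mP ≤ 2 ^ k * C) (k : ℕ) {a : ℝ} (hh : h ∈ F)
    (ha : ∀ j x, |iterQ P j h x| ≤ α ^ j * (a * g x)) :
    ∫ ω, (∑ u ∈ gen k, h (X u ω)) ^ 2 ∂mP ≤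
      4 ^ k * ((C / ((1 + α) / 2 - α ^ 2) + C) * ((1 + α) / 2) ^ k * a ^ 2) := by
  obtain ⟨hα0, hα1⟩ := hα
  set ρ := (1 + α) / 2 with hρ
  have hρα : 0 < ρ - α ^ 2 := by nlinarith
  set K := C / (ρ - α ^ 2) + C with hK
  have hK0 : 0 ≤ K := by positivity
  have hKC : C ≤ K * (ρ - α ^ 2) := by
    have : C / (ρ - α ^ 2) * (ρ - α ^ 2) = C := div_mul_cancel₀ _ hρα.ne'
    nlinarith [mul_nonneg hC0 hρα.le]
  have hbase : ∀ (k : ℕ) (h : S → ℝ) (a : ℝ), h ∈ F →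
      (∀ j x, |iterQ P j h x| ≤ α ^ j * (a * g x)) →
      ∑ u ∈ gen k, ∫ ω, h (X u ω) ^ 2 ∂mP ≤ a ^ 2 * (2 ^ k * C) := by
    intro k h a hh ha
    refine le_trans ?_ (mul_le_mul_of_nonneg_left (hC k) (sq_nonneg a))
    rw [Finset.mul_sum]
    refine Finset.sum_le_sum fun u _ => ?_
    rw [← integral_const_mul]
    refine integral_mono (hX.integrable_comp hF (hF.sq_mem h hh) u)
      ((hX.integrable_comp hF (hF.sq_mem g hg) u).const_mul _) fun ω => ?_
    have h0 := ha 0 (X u ω)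
    rw [pow_zero, one_mul] at h0
    have h1 := pow_le_pow_left₀ (abs_nonneg _) h0 2
    rw [sq_abs, mul_pow] at h1
    exact h1
  induction k generalizing h a with
  | zero =>
    have := hbase 0 h a hh ha
    simp only [sum_gen_zero, pow_zero, one_mul, mul_one] at this ⊢
    have hCK : C ≤ K := by
      rw [hK]
      have : 0 ≤ C / (ρ - α ^ 2) := by positivity
      linarith
    nlinarith [sq_nonneg a]
  | succ k ih =>
    have hstep := hX.integral_sum_sq_succ_le hF hh k
    have h1 := ih (h := actQ P h) (a := α * a) (hF.actQ_mem hh) fun j x => by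
      have := ha (j + 1) x
      rw [pow_succ] at this
      calc |iterQ P j (actQ P h) x| ≤ α ^ j * α * (a * g x) := this
        _ = _ := by ring
    have h2 := hbase (k + 1) h a hh ha
    -- Here `ρ ≥ 1/2` is used: the diagonal term, of order `2^k`, must not exceed `(4ρ)^k`.
    have h24 : (2 : ℝ) ^ k ≤ 4 ^ k * ρ ^ k := by
      rw [← mul_pow]
      exact pow_le_pow_left₀ (by norm_num) (by linarith) k
    have h3 : C * 2 ^ k ≤ K * (ρ - α ^ 2) * (4 ^ k * ρ ^ k) :=
      mul_le_mul (by linarith) h24 (by positivity) (by positivity)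
    have h4 := mul_le_mul_of_nonneg_left h3 (sq_nonneg a)
    calc _ ≤ 4 * (4 ^ k * (K * ρ ^ k * (α * a) ^ 2)) + 2 * (a ^ 2 * (2 ^ (k + 1) * C)) := by
          linarith
      _ = 4 * (4 ^ k * (K * ρ ^ k * (α * a) ^ 2)) + 4 * (a ^ 2 * (C * 2 ^ k)) := by ring
      _ ≤ 4 * (4 ^ k * (K * ρ ^ k * (α * a) ^ 2)) +
          4 * (a ^ 2 * (K * (ρ - α ^ 2) * (4 ^ k * ρ ^ k))) := by linarith
      _ = _ := by ring

end FunctionSpace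

/-! ### Elementary estimates for exponentials and products -/

section Estimates

/-- For `|y| ≤ 1` this is the exponential series remainder; for `|y| > 1` the trivial bound `2 + |y|
+ y²/2` is already below `4|y|³`. The constant is not sharp. -/
theorem norm_cexp_I_mul_sub_taylor_le (y : ℝ) :
    ‖Complex.exp (Complex.I * y) - (1 + Complex.I * y - (y : ℂ) ^ 2 / 2)‖ ≤ 4 * |y| ^ 3 := by
  have hn : ‖Complex.I * (y : ℂ)‖ = |y| := by simp
  by_cases hy : |y| ≤ 1
  · have h := Complex.exp_bound (x := Complex.I * y) (by rwa [hn]) (n := 3) (by norm_num)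
    rw [hn] at h
    have e : ∑ m ∈ Finset.range 3, (Complex.I * (y : ℂ)) ^ m / (m.factorial : ℂ) =
        1 + Complex.I * y - (y : ℂ) ^ 2 / 2 := by
      simp [Finset.sum_range_succ, Nat.factorial, mul_pow]
      ring
    rw [e] at h
    refine h.trans ?_
    rw [mul_comm]
    refine mul_le_mul_of_nonneg_right ?_ (by positivity)
    norm_num [Nat.factorial]
  · have hy1 : 1 < |y| := not_le.1 hy
    have h1 : ‖Complex.exp (Complex.I * y)‖ = 1 := by
      rw [mul_comm]
      exact Complex.norm_exp_ofReal_mul_I y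
    have h2 : ‖(1 + Complex.I * y - (y : ℂ) ^ 2 / 2 : ℂ)‖ ≤ 1 + |y| + |y| ^ 2 / 2 := by
      refine (norm_sub_le _ _).trans (add_le_add ((norm_add_le _ _).trans ?_) ?_)
      · rw [hn, norm_one]
      · simp
    refine (norm_sub_le _ _).trans ?_
    rw [h1]
    nlinarith [mul_pos (sub_pos.2 hy1) (sub_pos.2 hy1), pow_pos (sub_pos.2 hy1) 3]

theorem abs_exp_neg_sub_le {x : ℝ} (hx : 0 ≤ x) : |Real.exp (-x) - (1 - x)| ≤ x ^ 2 := by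
  by_cases h : x ≤ 1
  · have := Real.abs_exp_sub_one_sub_id_le (x := -x) (by rwa [abs_neg, abs_of_nonneg hx])
    rw [neg_sq] at this
    convert this using 2
    ring
  · have h1 := Real.add_one_le_exp (-x)
    have h2 : Real.exp (-x) ≤ 1 := Real.exp_le_one_iff.2 (by linarith)
    rw [abs_le]
    constructor <;> nlinarith

theorem abs_exp_neg_sub_exp_neg_le {a b : ℝ} (ha : 0 ≤ a) (hb : 0 ≤ b) :
    |Real.exp (-a) - Real.exp (-b)| ≤ |a - b| := by
  wlog hab : a ≤ b generalizing a b
  · rw [abs_sub_comm, abs_sub_comm a]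
    exact this hb ha (le_of_not_ge hab)
  have h1 : Real.exp (-b) = Real.exp (-a) * Real.exp (-(b - a)) := by
    rw [← Real.exp_add]
    congr 1
    ring
  have h2 := Real.add_one_le_exp (-(b - a))
  have h3 : Real.exp (-a) ≤ 1 := Real.exp_le_one_iff.2 (by linarith)
  have h4 : Real.exp (-(b - a)) ≤ 1 := Real.exp_le_one_iff.2 (by linarith)
  rw [abs_of_nonneg (by rw [h1]; nlinarith [Real.exp_pos (-a)]), abs_of_nonpos (by linarith), h1]
  nlinarith [Real.exp_pos (-a)]

theorem norm_prod_sub_prod_le {ι 𝕜 : Type*} [NormedField 𝕜] (s : Finset ι) {a b : ι → 𝕜}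
    (ha : ∀ i, ‖a i‖ ≤ 1) (hb : ∀ i, ‖b i‖ ≤ 1) :
    ‖∏ i ∈ s, a i - ∏ i ∈ s, b i‖ ≤ ∑ i ∈ s, ‖a i - b i‖ := by
  classical
  induction s using Finset.induction_on with
  | empty => simp
  | insert i s hi ih =>
    rw [Finset.prod_insert hi, Finset.prod_insert hi, Finset.sum_insert hi]
    have hB : ‖∏ i ∈ s, b i‖ ≤ 1 := by
      simpa using norm_prod_le_prod_const s (C := fun _ => 1) fun i _ => hb i
    have e : a i * ∏ i ∈ s, a i - b i * ∏ i ∈ s, b i =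
        (a i - b i) * ∏ i ∈ s, b i + a i * (∏ i ∈ s, a i - ∏ i ∈ s, b i) := by ring
    rw [e]
    refine (norm_add_le _ _).trans (add_le_add ?_ ?_)
    · rw [norm_mul]
      exact mul_le_of_le_one_right (norm_nonneg _) hB
    · rw [norm_mul]
      exact (mul_le_of_le_one_left (norm_nonneg _) (ha i)).trans ih

/-- Factors of norm at most 1 do not amplify earlier errors, so one-step errors simply add up. -/
theorem norm_sub_prod_le_sum {𝕜 : Type*} [NormedField 𝕜] {z c : ℕ → 𝕜} {e : ℕ → ℝ}
    (h0 : z 0 = 1) (hc : ∀ k, ‖c k‖ ≤ 1) (n : ℕ)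
    (h : ∀ k < n, ‖z (k + 1) - c k * z k‖ ≤ e k) :
    ‖z n - ∏ k ∈ Finset.range n, c k‖ ≤ ∑ k ∈ Finset.range n, e k := by
  induction n with
  | zero => simp [h0]
  | succ n ih =>
    rw [Finset.prod_range_succ, Finset.sum_range_succ]
    have e1 : z (n + 1) - (∏ k ∈ Finset.range n, c k) * c n =
        c n * (z n - ∏ k ∈ Finset.range n, c k) + (z (n + 1) - c n * z n) := by ring
    rw [e1]
    refine (norm_add_le _ _).trans (add_le_add ?_ (h n n.lt_succ_self))
    rw [norm_mul]
    exact (mul_le_of_le_one_left (norm_nonneg _) (hc n)).trans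
      (ih fun k hk => h k (hk.trans n.lt_succ_self))

variable {E : Type*} [MeasurableSpace E] {κ : Measure E} [IsProbabilityMeasure κ]

theorem sq_integral_le_integral_sq {Y : E → ℝ} (hY : MemLp Y 2 κ) :
    (∫ y, Y y ∂κ) ^ 2 ≤ ∫ y, Y y ^ 2 ∂κ := by
  have := variance_nonneg Y κ
  rw [variance_eq_sub hY] at this
  exact sub_nonneg.1 this

theorem integral_abs_le_sqrt {Y : E → ℝ} (hY : MemLp Y 2 κ) :
    ∫ y, |Y y| ∂κ ≤ √(∫ y, Y y ^ 2 ∂κ) := by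
  refine Real.le_sqrt_of_sq_le ?_
  simpa using sq_integral_le_integral_sq hY.abs

/-- Both sides are compared with `1 - s² m2 / 2`. Only second and fourth moments are needed, because
`|y|³ ≤ y² + y⁴` and `m2² ≤ m4`. -/
theorem norm_integral_cexp_sub_exp_le {f : E → ℝ} (hf : Measurable f) (h1 : Integrable f κ)
    (h2 : Integrable (fun y => f y ^ 2) κ) (h4 : Integrable (fun y => f y ^ 4) κ)
    (h0 : ∫ y, f y ∂κ = 0) (s : ℝ) :
    ‖∫ y, Complex.exp (Complex.I * ((s * f y : ℝ) : ℂ)) ∂κ -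
        ((Real.exp (-(s ^ 2 / 2 * ∫ y, f y ^ 2 ∂κ)) : ℝ) : ℂ)‖ ≤
      (4 * |s| ^ 3 + s ^ 4) * (∫ y, f y ^ 2 ∂κ + ∫ y, f y ^ 4 ∂κ) := by
  set m2 := ∫ y, f y ^ 2 ∂κ with hm2
  set m4 := ∫ y, f y ^ 4 ∂κ with hm4
  have hm2_nonneg : 0 ≤ m2 := integral_nonneg fun _ => sq_nonneg _
  have hm24 : m2 ^ 2 ≤ m4 := by
    have : MemLp (fun y => f y ^ 2) 2 κ :=
      (memLp_two_iff_integrable_sq (hf.pow_const 2).aestronglyMeasurable).2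
        (h4.congr (ae_of_all _ fun y => by ring))
    refine (sq_integral_le_integral_sq this).trans (le_of_eq ?_)
    exact integral_congr_ae (ae_of_all _ fun y => by simp only; ring)
  have hexp : Integrable (fun y => Complex.exp (Complex.I * ((s * f y : ℝ) : ℂ))) κ := by
    refine integrable_of_forall_norm_le (by fun_prop) (C := 1) fun y => ?_
    rw [mul_comm, Complex.norm_exp_ofReal_mul_I]
  have hlin : Integrable (fun y => (1 : ℂ) + Complex.I * ((s * f y : ℝ) : ℂ)) κ :=
    (integrable_const _).add ((h1.const_mul s).ofReal.const_mul _)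
  have hquad : Integrable (fun y => ((s * f y : ℝ) : ℂ) ^ 2 / 2) κ := by
    refine ((h2.const_mul (s ^ 2 / 2)).ofReal (𝕜 := ℂ)).congr (ae_of_all _ fun y => ?_)
    simp
    ring
  have hT : ∫ y, ((1 : ℂ) + Complex.I * ((s * f y : ℝ) : ℂ) - ((s * f y : ℝ) : ℂ) ^ 2 / 2) ∂κ =
      ((1 - s ^ 2 / 2 * m2 : ℝ) : ℂ) := by
    rw [integral_sub hlin hquad, integral_add (integrable_const _)
      ((h1.const_mul s).ofReal.const_mul _), integral_const_mul, integral_complex_ofReal,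
      integral_const_mul, h0]
    have e : ∀ y, ((s * f y : ℝ) : ℂ) ^ 2 / 2 = ((s ^ 2 / 2 * f y ^ 2 : ℝ) : ℂ) := by
      intro y
      push_cast
      ring
    simp_rw [e]
    rw [integral_complex_ofReal, integral_const_mul]
    simp [← hm2]
  have b1 : ‖∫ y, Complex.exp (Complex.I * ((s * f y : ℝ) : ℂ)) ∂κ -
      ((1 - s ^ 2 / 2 * m2 : ℝ) : ℂ)‖ ≤ 4 * |s| ^ 3 * (m2 + m4) := by
    have hdiff : Integrable (fun y => (1 : ℂ) + Complex.I * ((s * f y : ℝ) : ℂ) -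
        ((s * f y : ℝ) : ℂ) ^ 2 / 2) κ := hlin.sub hquad
    rw [← hT, ← integral_sub hexp hdiff, hm2, hm4, ← integral_add h2 h4,
      ← integral_const_mul]
    refine norm_integral_le_of_norm_le ((h2.add h4).const_mul _) (ae_of_all _ fun y => ?_)
    refine (norm_cexp_I_mul_sub_taylor_le (s * f y)).trans ?_
    rw [abs_mul, mul_pow, ← mul_assoc]
    refine mul_le_mul_of_nonneg_left ?_ (by positivity)
    have e2 : f y ^ 2 = |f y| ^ 2 := (sq_abs _).symm
    have e4 : f y ^ 4 = |f y| ^ 4 := by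
      rw [← abs_pow, abs_of_nonneg (by positivity)]
    simp only [e2, e4]
    nlinarith [sq_nonneg (|f y| ^ 2 - |f y|), abs_nonneg (f y), sq_nonneg (|f y|),
      sq_nonneg (|f y| ^ 2)]
  have b2 : ‖((1 - s ^ 2 / 2 * m2 : ℝ) : ℂ) - ((Real.exp (-(s ^ 2 / 2 * m2)) : ℝ) : ℂ)‖ ≤
      s ^ 4 * (m2 + m4) := by
    rw [← Complex.ofReal_sub, Complex.norm_real, Real.norm_eq_abs, abs_sub_comm]
    refine (abs_exp_neg_sub_le (by positivity)).trans ?_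
    have hs : 0 ≤ s ^ 4 := by positivity
    calc (s ^ 2 / 2 * m2) ^ 2 = s ^ 4 * (m2 ^ 2 / 4) := by ring
      _ ≤ s ^ 4 * (m2 + m4) := mul_le_mul_of_nonneg_left (by nlinarith) hs
  calc _ ≤ _ := norm_sub_le_norm_sub_add_norm_sub _ ((1 - s ^ 2 / 2 * m2 : ℝ) : ℂ) _
    _ ≤ _ := add_le_add b1 b2
    _ = _ := by ring

end Estimates

/-! ### Law of large numbers and the factor of one generation -/

section Generation

variable {S : Type*} [MeasurableSpace S] {ν : Measure S} {P : Kernel S (S × S)}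
  {F : Submodule ℝ (S → ℝ)} {Ω : Type*} [MeasurableSpace Ω] {mP : Measure Ω}
  {X : List Bool → Ω → S} [IsProbabilityMeasure mP] [IsMarkovKernel P]

/-- Apply the second moment bound to `h - c` and take a square root by Cauchy–Schwarz; `√(4^k)`
cancels the normalisation `2^k`. The constants depend on `h` only through `g`, so the rate is
uniform along a sequence sharing one `g`. -/
theorem IsBMC.integral_abs_mean_sub_le (hX : IsBMC mP ν P X) (hF : Structural ν P F)
    {α : ℝ} (hα : α ∈ Set.Ioo (0 : ℝ) 1) {g : S → ℝ} (hg : g ∈ F) {C : ℝ} (hC0 : 0 ≤ C)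
    (hC : ∀ k, ∑ u ∈ gen k, ∫ ω, g (X u ω) ^ 2 ∂mP ≤ 2 ^ k * C) {h : S → ℝ} (hh : h ∈ F) {c : ℝ}
    (hc : ∀ j x, |iterQ P j h x - c| ≤ α ^ j * g x) (k : ℕ) :
    ∫ ω, |(2 ^ k)⁻¹ * ∑ u ∈ gen k, h (X u ω) - c| ∂mP ≤
      √(C / ((1 + α) / 2 - α ^ 2) + C) * √((1 + α) / 2) ^ k := by
  have hh' : (fun x => h x - c) ∈ F := F.sub_mem hh (hF.const_mem c)
  have hbd := hX.integral_sum_sq_le_geometric hF hα hg hC0 hC k (a := 1) hh' fun j x => by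
    rw [hF.iterQ_sub_const hh, one_mul]
    exact hc j x
  have hL : ∀ u, MemLp (fun ω => h (X u ω) - c) 2 mP := fun u =>
    (memLp_two_iff_integrable_sq
      ((hF.measurable _ hh').comp (hX.measurable u)).aestronglyMeasurable).2
      (hX.integrable_comp hF (hF.sq_mem _ hh') u)
  have hLs : MemLp (fun ω => ∑ u ∈ gen k, (h (X u ω) - c)) 2 mP := by
    simpa using memLp_finsetSum (gen k) fun u _ => hL u
  have h2k : (0 : ℝ) < 2 ^ k := by positivity
  have e : ∀ ω, |(2 ^ k)⁻¹ * ∑ u ∈ gen k, h (X u ω) - c| =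
      (2 ^ k)⁻¹ * |∑ u ∈ gen k, (h (X u ω) - c)| := by
    intro ω
    rw [Finset.sum_sub_distrib, Finset.sum_const, card_gen, nsmul_eq_mul]
    nth_rewrite 2 [← abs_of_pos (inv_pos.2 h2k)]
    rw [← abs_mul]
    congr 1
    push_cast
    field_simp
  simp_rw [e]
  rw [integral_const_mul]
  have h1 := (integral_abs_le_sqrt hLs).trans (Real.sqrt_le_sqrt hbd)
  have h4 : √((4 : ℝ) ^ k) = 2 ^ k := by
    rw [show (4 : ℝ) ^ k = (2 ^ k) ^ 2 by rw [← pow_mul, mul_comm, pow_mul]; norm_num]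
    exact Real.sqrt_sq h2k.le
  have hρ : (0 : ℝ) ≤ (1 + α) / 2 := by linarith [hα.1]
  have hK : 0 ≤ C / ((1 + α) / 2 - α ^ 2) + C := by
    have : 0 < (1 + α) / 2 - α ^ 2 := by nlinarith [hα.1, hα.2]
    positivity
  have h5 : √(((1 + α) / 2) ^ k) = √((1 + α) / 2) ^ k :=
    (Real.sqrt_eq_iff_mul_self_eq (by positivity) (by positivity)).2 (by
      rw [← mul_pow, Real.mul_self_sqrt hρ])
  rw [one_pow, mul_one, Real.sqrt_mul (by positivity), Real.sqrt_mul hK, h4, h5] at h1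
  calc _ ≤ (2 ^ k)⁻¹ * _ := mul_le_mul_of_nonneg_left h1 (by positivity)
    _ = _ := by field_simp

/-- One generation contributes an almost Gaussian factor to the characteristic function. -/
theorem IsBMC.norm_integral_mul_cexp_sub_le (hX : IsBMC mP ν P X) (hF : Structural ν P F)
    (k : ℕ) {f : S × S × S → ℝ} (hf : Measurable f)
    (h1 : ∀ x, Integrable (fun p : S × S => f (x, p.1, p.2)) (P x))
    (h2 : ∀ x, Integrable (fun p : S × S => f (x, p.1, p.2) ^ 2) (P x))
    (h4 : ∀ x, Integrable (fun p : S × S => f (x, p.1, p.2) ^ 4) (P x))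
    (h0 : ∀ x, actTri P f x = 0) (hm2 : actTri P (fun y => f y ^ 2) ∈ F)
    (hm4 : actTri P (fun y => f y ^ 4) ∈ F) {z : Ω → ℂ} (hz : Measurable[sigmaUpTo X k] z)
    (hz1 : ∀ ω, ‖z ω‖ ≤ 1) (s : ℝ) {x : ℝ} (hx : 0 ≤ x) :
    ‖∫ ω, z ω * Complex.exp (Complex.I * ((s * addFun X (gen k) f ω : ℝ) : ℂ)) ∂mP -
        ((Real.exp (-x) : ℝ) : ℂ) * ∫ ω, z ω ∂mP‖ ≤
      (4 * |s| ^ 3 + s ^ 4) * ∑ u ∈ gen k, ∫ ω, (actTri P (fun y => f y ^ 2) (X u ω) +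
          actTri P (fun y => f y ^ 4) (X u ω)) ∂mP +
        ∫ ω, |s ^ 2 / 2 * ∑ u ∈ gen k, actTri P (fun y => f y ^ 2) (X u ω) - x| ∂mP := by
  set H2 := actTri P (fun y => f y ^ 2) with hH2
  set H4 := actTri P (fun y => f y ^ 4) with hH4
  have hzm := hz.mono (hX.sigmaUpTo_le k) le_rfl
  have hexp1 : ∀ y : ℝ, ‖Complex.exp (Complex.I * (y : ℂ))‖ = 1 := fun y => by
    rw [mul_comm, Complex.norm_exp_ofReal_mul_I]
  let G : S × S × S → ℂ := fun y => Complex.exp (Complex.I * ((s * f y : ℝ) : ℂ))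
  have hGm : Measurable G := by fun_prop
  have hG1 : ∀ y, ‖G y‖ ≤ 1 := fun y => (hexp1 _).le
  let φ : S → ℂ := fun x => ∫ p, G (x, p) ∂(P x)
  have hφm : Measurable φ := measurable_integral_kernel hGm
  have hφ1 : ∀ x, ‖φ x‖ ≤ 1 := fun x => norm_integral_kernel_le hG1 x
  -- `ψ` is the Gaussian characteristic function with the conditional variance of `f`; it
  -- interpolates between the true factor `φ` and the constant `exp (-x)`.
  let ψ : S → ℂ := fun x => ((Real.exp (-(s ^ 2 / 2 * H2 x)) : ℝ) : ℂ)
  have hH2_nonneg : ∀ x, 0 ≤ H2 x := fun x => integral_nonneg fun _ => sq_nonneg _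
  have hψ1 : ∀ x, ‖ψ x‖ ≤ 1 := by
    intro x
    have : 0 ≤ s ^ 2 / 2 * H2 x := mul_nonneg (by positivity) (hH2_nonneg x)
    rw [Complex.norm_real, Real.norm_eq_abs, Real.abs_exp]
    exact Real.exp_le_one_iff.2 (by linarith)
  have hφψ : ∀ x, ‖φ x - ψ x‖ ≤ (4 * |s| ^ 3 + s ^ 4) * (H2 x + H4 x) := fun x =>
    norm_integral_cexp_sub_exp_le (κ := P x) (f := fun p => f (x, p.1, p.2))
      (hf.comp (by fun_prop)) (h1 x) (h2 x) (h4 x) (h0 x) s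
  have hbranch := hX.integral_mul_prod_complex k hz hz1 (g := fun _ => G) (fun _ => hGm)
    (fun _ => hG1)
  have e1 : ∀ ω, Complex.exp (Complex.I * ((s * addFun X (gen k) f ω : ℝ) : ℂ)) =
      ∏ u ∈ gen k, G (triangle X u ω) := by
    intro ω
    rw [← Complex.exp_sum, ← Finset.mul_sum, ← Complex.ofReal_sum, ← Finset.mul_sum]
    rfl
  have hprodm : Measurable fun ω => ∏ u ∈ gen k, φ (X u ω) :=
    Finset.measurable_fun_prod _ fun u _ => hφm.comp (hX.measurable u)
  have hprod1 : ∀ ω, ‖∏ u ∈ gen k, φ (X u ω)‖ ≤ 1 := fun ω => by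
    simpa using norm_prod_le_prod_const (gen k) (C := fun _ => 1) fun u _ => hφ1 (X u ω)
  have i1 : Integrable (fun ω => z ω * ∏ u ∈ gen k, φ (X u ω)) mP :=
    integrable_of_forall_norm_le (hzm.mul hprodm) (C := 1) fun ω => by
      rw [norm_mul]
      exact mul_le_one₀ (hz1 ω) (norm_nonneg _) (hprod1 ω)
  have i2 : Integrable z mP := integrable_of_forall_norm_le hzm hz1
  have iH : ∀ u, Integrable (fun ω => H2 (X u ω) + H4 (X u ω)) mP := fun u =>
    (hX.integrable_comp hF hm2 u).add (hX.integrable_comp hF hm4 u)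
  have iV : Integrable (fun ω => |s ^ 2 / 2 * ∑ u ∈ gen k, H2 (X u ω) - x|) mP :=
    (((integrable_finsetSum _ fun u _ => hX.integrable_comp hF hm2 u).const_mul _).sub
      (integrable_const x)).abs
  simp_rw [e1]
  rw [hbranch, ← integral_const_mul, ← integral_sub i1 (i2.const_mul _),
    ← integral_finsetSum _ fun u _ => iH u, ← integral_const_mul,
    ← integral_add ((integrable_finsetSum _ fun u _ => iH u).const_mul _) iV]
  refine norm_integral_le_of_norm_le
    (((integrable_finsetSum _ fun u _ => iH u).const_mul _).add iV) (ae_of_all _ fun ω => ?_)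
  have hprodψ : ∏ u ∈ gen k, ψ (X u ω) =
      ((Real.exp (-(s ^ 2 / 2 * ∑ u ∈ gen k, H2 (X u ω))) : ℝ) : ℂ) := by
    rw [← Complex.ofReal_prod, ← Real.exp_sum, Finset.sum_neg_distrib, ← Finset.mul_sum]
  have b1 : ‖∏ u ∈ gen k, φ (X u ω) - ∏ u ∈ gen k, ψ (X u ω)‖ ≤
      (4 * |s| ^ 3 + s ^ 4) * ∑ u ∈ gen k, (H2 (X u ω) + H4 (X u ω)) := by
    rw [Finset.mul_sum]
    exact (norm_prod_sub_prod_le _ (fun u => hφ1 _) fun u => hψ1 _).trans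
      (Finset.sum_le_sum fun u _ => hφψ _)
  have b2 : ‖∏ u ∈ gen k, ψ (X u ω) - ((Real.exp (-x) : ℝ) : ℂ)‖ ≤
      |s ^ 2 / 2 * ∑ u ∈ gen k, H2 (X u ω) - x| := by
    rw [hprodψ, ← Complex.ofReal_sub, Complex.norm_real, Real.norm_eq_abs]
    exact abs_exp_neg_sub_exp_neg_le
      (mul_nonneg (by positivity) (Finset.sum_nonneg fun u _ => hH2_nonneg _)) hx
  have e2 : z ω * ∏ u ∈ gen k, φ (X u ω) - ((Real.exp (-x) : ℝ) : ℂ) * z ω =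
      z ω * (∏ u ∈ gen k, φ (X u ω) - ((Real.exp (-x) : ℝ) : ℂ)) := by ring
  change ‖z ω * ∏ u ∈ gen k, φ (X u ω) - ((Real.exp (-x) : ℝ) : ℂ) * z ω‖ ≤ _
  rw [e2, norm_mul]
  refine (mul_le_of_le_one_left (norm_nonneg _) (hz1 ω)).trans ?_
  exact (norm_sub_le_norm_sub_add_norm_sub _ (∏ u ∈ gen k, ψ (X u ω)) _).trans (add_le_add b1 b2)

end Generation

/-! ### Assembling the generations -/

section Fluctuation

variable {S : Type*} [MeasurableSpace S] {ν : Measure S} {P : Kernel S (S × S)}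
  {F : Submodule ℝ (S → ℝ)} {Ω : Type*} [MeasurableSpace Ω] {mP : Measure Ω}
  {X : List Bool → Ω → S} {μ : Measure S} {α : ℝ} {f : ℕ → S × S × S → ℝ}

/-- Each of the `n + 1` terms is at most `r^n`, as `2⁻¹` may be replaced by `r`. -/
theorem sum_geometric_mul_le {r : ℝ} (hr : 2⁻¹ ≤ r) (n : ℕ) :
    ∑ k ∈ Finset.range (n + 1), (2 : ℝ)⁻¹ ^ (n - k) * r ^ k ≤ (n + 1) * r ^ n := by
  have : ∀ k ∈ Finset.range (n + 1), (2 : ℝ)⁻¹ ^ (n - k) * r ^ k ≤ r ^ n := by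
    intro k hk
    have hr0 : 0 ≤ r := le_trans (by norm_num) hr
    have hk' : k ≤ n := Nat.lt_succ_iff.1 (Finset.mem_range.1 hk)
    calc (2 : ℝ)⁻¹ ^ (n - k) * r ^ k ≤ r ^ (n - k) * r ^ k :=
          mul_le_mul_of_nonneg_right (pow_le_pow_left₀ (by norm_num) hr _) (by positivity)
      _ = r ^ n := by rw [← pow_add, Nat.sub_add_cancel hk']
  simpa using Finset.sum_le_card_nsmul _ _ _ this

theorem fluctuation_eq {Ω : Type*} {X : List Bool → Ω → S}
    (hPf : ∀ l x, actTri P (f l) x = 0) (n : ℕ) (ω : Ω) :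
    fluctuation P μ X f n ω =
      (√(2 ^ n))⁻¹ * ∑ k ∈ Finset.range (n + 1), addFun X (gen k) (f (n - k)) ω := by
  have hc : ∀ l, centred P μ (f l) = f l := by
    intro l
    funext y
    simp [centred, hPf]
  rw [fluctuation, card_gen, ← Finset.sum_range_reflect]
  simp only [hc]
  push_cast
  congr 1
  refine Finset.sum_congr rfl fun k hk => ?_
  have hk' : k ≤ n := Nat.lt_succ_iff.1 (Finset.mem_range.1 hk)
  rw [Nat.sub_sub_self hk']

/-- The uniform bound at iterate 0 dominates every mean by `⟨μ, g⟩`, leaving a geometric series. -/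
theorem UniformPower.summable_variance [IsProbabilityMeasure μ] (hμ : GeomErgodic P F μ α)
    (h2 : UniformPower P F μ α f 2) :
    Summable fun l : ℕ => (2 : ℝ)⁻¹ ^ l * ∫ x, actTri P (fun y => f l y ^ 2) x ∂μ := by
  obtain ⟨-, hmem, g, hg, hb⟩ := h2
  refine Summable.of_norm_bounded (g := fun l : ℕ => (2 : ℝ)⁻¹ ^ l * ∫ x, g x ∂μ)
    ((summable_geometric_of_lt_one (by norm_num) (by norm_num)).mul_right _) fun l => ?_
  rw [norm_mul, norm_pow, norm_inv, Real.norm_ofNat]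
  refine mul_le_mul_of_nonneg_left ?_ (by positivity)
  exact norm_integral_le_of_norm_le (hμ.integrable g hg) (ae_of_all _ fun x => (hb 0 l x).1)

variable [IsProbabilityMeasure mP] [IsMarkovKernel P] [IsProbabilityMeasure ν]

/-- Distance of the characteristic function of the fluctuation to a Gaussian one. -/
theorem IsBMC.exists_norm_integral_cexp_fluctuation_sub_le
    (hX : IsBMC mP ν P X) (hF : Structural ν P F) (hα : α ∈ Set.Ioo (0 : ℝ) 1)
    (hμ : GeomErgodic P F μ α) (hf : ∀ l, Measurable (f l)) (h1 : UniformPower P F μ α f 1)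
    (h2 : UniformPower P F μ α f 2) (h4 : UniformPower P F μ α f 4)
    (hPf : ∀ l x, actTri P (f l) x = 0) :
    ∃ C K : ℝ, ∀ (t : ℝ) (n : ℕ),
      ‖∫ ω, Complex.exp (Complex.I * ((t * fluctuation P μ X f n ω : ℝ) : ℂ)) ∂mP -
          ((Real.exp (-(t ^ 2 / 2 * ∑ l ∈ Finset.range (n + 1),
            (2 : ℝ)⁻¹ ^ l * ∫ x, actTri P (fun y => f l y ^ 2) x ∂μ)) : ℝ) : ℂ)‖ ≤
        (4 * |t * (√(2 ^ n))⁻¹| + (t * (√(2 ^ n))⁻¹) ^ 2) * t ^ 2 * C +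
          t ^ 2 / 2 * K * ((n + 1) * √((1 + α) / 2) ^ n) := by
  obtain ⟨h2i, h2mem, g2, hg2, hb2⟩ := h2
  obtain ⟨h4i, h4mem, g4, hg4, hb4⟩ := h4
  obtain ⟨C, hC0, hC⟩ := hX.exists_sum_integral_le hF hα hμ (F.add_mem hg2 hg4)
  obtain ⟨D, hD0, hD⟩ := hX.exists_sum_integral_le hF hα hμ (hF.sq_mem g2 hg2)
  set H2 : ℕ → S → ℝ := fun l => actTri P fun y => f l y ^ 2 with hH2
  set H4 : ℕ → S → ℝ := fun l => actTri P fun y => f l y ^ 4 with hH4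
  have hH2_nonneg : ∀ l x, 0 ≤ H2 l x := fun l x => integral_nonneg fun _ => sq_nonneg _
  set K := √(D / ((1 + α) / 2 - α ^ 2) + D) with hK
  refine ⟨2 * C, K, fun t n => ?_⟩
  set s := t * (√(2 ^ n))⁻¹ with hs
  have hs2 : s ^ 2 * 2 ^ n = t ^ 2 := by
    rw [hs, mul_pow, inv_pow, Real.sq_sqrt (by positivity)]
    field_simp
  -- `T k` collects the generations strictly before `k`. Their triangles reach at most generation
  -- `k`, so `T k` is known when generation `k` branches.
  let T : ℕ → Ω → ℝ := fun k ω => ∑ j ∈ Finset.range k, addFun X (gen j) (f (n - j)) ω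
  let Z : ℕ → Ω → ℂ := fun k ω => Complex.exp (Complex.I * ((s * T k ω : ℝ) : ℂ))
  let x : ℕ → ℝ := fun k => t ^ 2 / 2 * ((2 : ℝ)⁻¹ ^ (n - k) * ∫ y, H2 (n - k) y ∂μ)
  have hx : ∀ k, 0 ≤ x k := fun k =>
    mul_nonneg (by positivity) (mul_nonneg (by positivity) (integral_nonneg (hH2_nonneg _)))
  have hTm : ∀ k, Measurable[sigmaUpTo X k] (T k) := by
    intro k
    refine Finset.measurable_fun_sum _ fun j hj => Finset.measurable_fun_sum _ fun u hu => ?_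
    refine (hf _).comp (measurable_triangle_sigmaUpTo X ?_)
    rw [mem_gen.1 hu]
    exact Finset.mem_range.1 hj
  have hZm : ∀ k, Measurable[sigmaUpTo X k] (Z k) := fun k =>
    Complex.measurable_exp.comp
      ((Complex.measurable_ofReal.comp ((hTm k).const_mul s)).const_mul Complex.I)
  have hZ1 : ∀ k ω, ‖Z k ω‖ ≤ 1 := fun k ω => by
    simp only [Z]
    rw [mul_comm, Complex.norm_exp_ofReal_mul_I]
  have hZsucc : ∀ k ω, Z (k + 1) ω =
      Z k ω * Complex.exp (Complex.I * ((s * addFun X (gen k) (f (n - k)) ω : ℝ) : ℂ)) := by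
    intro k ω
    simp only [Z, T]
    rw [← Complex.exp_add, Finset.sum_range_succ]
    congr 1
    push_cast
    ring
  have hstep : ∀ k < n + 1, ‖∫ ω, Z (k + 1) ω ∂mP -
      ((Real.exp (-x k) : ℝ) : ℂ) * ∫ ω, Z k ω ∂mP‖ ≤
        (4 * |s| ^ 3 + s ^ 4) * (2 ^ k * C) +
          t ^ 2 / 2 * K * ((2 : ℝ)⁻¹ ^ (n - k) * √((1 + α) / 2) ^ k) := by
    intro k hk
    have hk' : k ≤ n := Nat.lt_succ_iff.1 hk
    simp_rw [hZsucc]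
    refine (hX.norm_integral_mul_cexp_sub_le hF k (hf (n - k))
      (fun x => by simpa using h1.1 (n - k) x) (h2i (n - k)) (h4i (n - k)) (hPf (n - k))
      (h2mem _) (h4mem _) (hZm k) (hZ1 k) s (hx k)).trans (add_le_add ?_ ?_)
    · refine mul_le_mul_of_nonneg_left (le_trans (Finset.sum_le_sum fun u _ => ?_) (hC k))
        (by positivity)
      refine integral_mono ((hX.integrable_comp hF (h2mem (n - k)) u).add
        (hX.integrable_comp hF (h4mem (n - k)) u))
        (hX.integrable_comp hF (F.add_mem hg2 hg4) u) fun ω => add_le_add ?_ ?_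
      · exact (le_abs_self _).trans (hb2 0 (n - k) _).1
      · exact (le_abs_self _).trans (hb4 0 (n - k) _).1
    · have hlln := hX.integral_abs_mean_sub_le hF hα hg2 hD0 hD (h2mem (n - k))
        (fun j x => (hb2 j (n - k) x).2) k
      -- Splitting `2^n` as `2^(n-k) · 2^k` turns the sum over generation `k` into an average with
      -- weight `2^(-(n-k))`, matching `x k`.
      have hpow : s ^ 2 = t ^ 2 * (2 : ℝ)⁻¹ ^ (n - k) * (2 ^ k)⁻¹ := by
        rw [← hs2]
        have : (2 : ℝ) ^ n = 2 ^ (n - k) * 2 ^ k := by rw [← pow_add, Nat.sub_add_cancel hk']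
        rw [this, inv_pow]
        field_simp
      have e : ∀ ω, |s ^ 2 / 2 * ∑ u ∈ gen k, H2 (n - k) (X u ω) - x k| =
          t ^ 2 / 2 * (2 : ℝ)⁻¹ ^ (n - k) *
            |(2 ^ k)⁻¹ * ∑ u ∈ gen k, H2 (n - k) (X u ω) - ∫ y, H2 (n - k) y ∂μ| := by
        intro ω
        have h0 : 0 ≤ t ^ 2 / 2 * (2 : ℝ)⁻¹ ^ (n - k) := by positivity
        rw [← abs_of_nonneg h0, ← abs_mul, hpow]
        congr 1
        simp only [x]
        ring
      calc _ = t ^ 2 / 2 * (2 : ℝ)⁻¹ ^ (n - k) * ∫ ω, |(2 ^ k)⁻¹ *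
            ∑ u ∈ gen k, H2 (n - k) (X u ω) - ∫ y, H2 (n - k) y ∂μ| ∂mP := by
            rw [← integral_const_mul]
            exact integral_congr_ae (ae_of_all _ e)
        _ ≤ t ^ 2 / 2 * (2 : ℝ)⁻¹ ^ (n - k) * (K * √((1 + α) / 2) ^ k) :=
            mul_le_mul_of_nonneg_left hlln (by positivity)
        _ = _ := by ring
  have htel := norm_sub_prod_le_sum (z := fun k => ∫ ω, Z k ω ∂mP)
    (c := fun k => ((Real.exp (-x k) : ℝ) : ℂ)) (by simp [Z, T]) (fun k => by
      rw [Complex.norm_real, Real.norm_eq_abs, Real.abs_exp]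
      exact Real.exp_le_one_iff.2 (neg_nonpos.2 (hx k))) (n + 1) hstep
  have hZn : ∀ ω, Complex.exp (Complex.I * ((t * fluctuation P μ X f n ω : ℝ) : ℂ)) =
      Z (n + 1) ω := by
    intro ω
    rw [fluctuation_eq hPf, ← mul_assoc]
  have hprod : ∏ k ∈ Finset.range (n + 1), ((Real.exp (-x k) : ℝ) : ℂ) =
      ((Real.exp (-(t ^ 2 / 2 * ∑ l ∈ Finset.range (n + 1),
        (2 : ℝ)⁻¹ ^ l * ∫ y, H2 l y ∂μ)) : ℝ) : ℂ) := by
    rw [← Complex.ofReal_prod, ← Real.exp_sum, Finset.sum_neg_distrib, ← Finset.mul_sum,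
      ← Finset.sum_range_reflect (fun l => (2 : ℝ)⁻¹ ^ l * ∫ y, H2 l y ∂μ)]
    simp only [Nat.add_sub_cancel]
  simp_rw [hZn]
  rw [hprod] at htel
  refine htel.trans ?_
  rw [Finset.sum_add_distrib, ← Finset.mul_sum, ← Finset.mul_sum, ← Finset.sum_mul]
  have hK0 : 0 ≤ K := Real.sqrt_nonneg _
  refine add_le_add ?_ (mul_le_mul_of_nonneg_left (sum_geometric_mul_le ?_ n) (by positivity))
  -- The total number of vertices is below `2 · 2^n`, whence the constant `2 * C`; one factor `s²
  -- 2^n = t²` absorbs it.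
  · have hgeom : ∑ k ∈ Finset.range (n + 1), (2 : ℝ) ^ k ≤ 2 ^ n * 2 := by
      rw [geom_sum_eq (by norm_num), pow_succ]
      norm_num
    calc _ ≤ (4 * |s| ^ 3 + s ^ 4) * (2 ^ n * 2 * C) :=
          mul_le_mul_of_nonneg_left (mul_le_mul_of_nonneg_right hgeom hC0) (by positivity)
      _ = (4 * |s| + s ^ 2) * (s ^ 2 * 2 ^ n) * (2 * C) := by
          rw [← sq_abs s]
          have : s ^ 4 = |s| ^ 4 := by rw [← abs_pow, abs_of_nonneg (by positivity)]
          rw [this]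
          ring
      _ = _ := by rw [hs2]
  · refine Real.le_sqrt_of_sq_le ?_
    have := hα.1
    norm_num
    linarith

end Fluctuation

end BMC


/-! ### The central limit theorem -/

theorem mainTheorem2 {S : Type*} [MeasurableSpace S] {Ω : Type*} [MeasurableSpace Ω]
    (mP : Measure Ω) [IsProbabilityMeasure mP]
    (ν : Measure S) [IsProbabilityMeasure ν]
    (P : Kernel S (S × S)) [IsMarkovKernel P]
    (X : List Bool → Ω → S) (hX : BMC.IsBMC mP ν P X)
    (F : Submodule ℝ (S → ℝ)) (hF : BMC.Structural ν P F)
    (μ : Measure S) [IsProbabilityMeasure μ]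
    (α : ℝ) (hα : α ∈ Set.Ioo (0 : ℝ) 1) (hμ : BMC.GeomErgodic P F μ α)
    (f : ℕ → S × S × S → ℝ) (hf : ∀ l, Measurable (f l))
    (h1 : BMC.UniformPower P F μ α f 1)
    (h2 : BMC.UniformPower P F μ α f 2)
    (h4 : BMC.UniformPower P F μ α f 4)
    (hPf : ∀ l x, BMC.actTri P (f l) x = 0) :
    ∃ σsq : ℝ≥0,
      HasSum (fun l : ℕ => (2 : ℝ)⁻¹ ^ l * ∫ x, BMC.actTri P (fun y => f l y ^ 2) x ∂μ)
        (σsq : ℝ) ∧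
      TendstoInDistribution (BMC.fluctuation P μ X f) atTop (id : ℝ → ℝ) (fun _ => mP)
        (gaussianReal 0 σsq) := by
  have hsum := h2.summable_variance hμ
  have hnonneg : 0 ≤ ∑' l : ℕ, (2 : ℝ)⁻¹ ^ l * ∫ x, BMC.actTri P (fun y => f l y ^ 2) x ∂μ :=
    tsum_nonneg fun l => mul_nonneg (by positivity)
      (integral_nonneg fun x => integral_nonneg fun _ => sq_nonneg _)
  obtain ⟨σsq, hσ⟩ : ∃ σsq : ℝ≥0, (σsq : ℝ) =
      ∑' l : ℕ, (2 : ℝ)⁻¹ ^ l * ∫ x, BMC.actTri P (fun y => f l y ^ 2) x ∂μ := ⟨⟨_, hnonneg⟩, rfl⟩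
  refine ⟨σsq, hσ ▸ hsum.hasSum, ?_⟩
  have hN : ∀ n, Measurable (BMC.fluctuation P μ X f n) := by
    intro n
    refine Measurable.const_mul (Finset.measurable_fun_sum _ fun l _ =>
      Finset.measurable_fun_sum _ fun u _ => ?_) _
    exact ((hf l).sub_const _).comp (hX.measurable_triangle u)
  obtain ⟨C, K, hCK⟩ := hX.exists_norm_integral_cexp_fluctuation_sub_le hF hα hμ hf h1 h2 h4 hPf
  refine ⟨fun n => (hN n).aemeasurable, aemeasurable_id, ?_⟩
  -- Lévy's continuity theorem reduces the claim to pointwise convergence of characteristic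
  -- functions.
  refine ProbabilityMeasure.tendsto_iff_tendsto_charFun.2 fun t => ?_
  simp only [ProbabilityMeasure.coe_mk, Measure.map_id, charFun_gaussianReal]
  have hchar : ∀ n, charFun (mP.map (BMC.fluctuation P μ X f n)) t =
      ∫ ω, Complex.exp (Complex.I * ((t * BMC.fluctuation P μ X f n ω : ℝ) : ℂ)) ∂mP := by
    intro n
    rw [charFun_apply_real, integral_map (hN n).aemeasurable (by fun_prop)]
    refine integral_congr_ae (ae_of_all _ fun ω => ?_)
    simp only
    congr 1
    push_cast
    ring
  simp_rw [hchar]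
  have hpow : Tendsto (fun n : ℕ => t * (√(2 ^ n : ℝ))⁻¹) atTop (nhds 0) := by
    rw [← mul_zero t]
    exact (tendsto_inv_atTop_zero.comp (Real.tendsto_sqrt_atTop.comp
      (tendsto_pow_atTop_atTop_of_one_lt one_lt_two))).const_mul t
  have hρ : Tendsto (fun n : ℕ => ((n : ℝ) + 1) * √((1 + α) / 2) ^ n) atTop (nhds 0) := by
    have hr0 : 0 ≤ √((1 + α) / 2) := Real.sqrt_nonneg _
    have hr1 : √((1 + α) / 2) < 1 := by
      rw [Real.sqrt_lt' one_pos]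
      linarith [hα.2]
    have := (tendsto_self_mul_const_pow_of_lt_one hr0 hr1).add
      (tendsto_pow_atTop_nhds_zero_of_lt_one hr0 hr1)
    rw [add_zero] at this
    refine this.congr fun n => ?_
    ring
  have hbound : Tendsto (fun n : ℕ => (4 * |t * (√(2 ^ n : ℝ))⁻¹| + (t * (√(2 ^ n : ℝ))⁻¹) ^ 2) *
      t ^ 2 * C + t ^ 2 / 2 * K * (((n : ℝ) + 1) * √((1 + α) / 2) ^ n)) atTop (nhds 0) := by
    have := ((((hpow.abs.const_mul 4).add (hpow.pow 2)).mul_const (t ^ 2)).mul_const C).add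
      (hρ.const_mul (t ^ 2 / 2 * K))
    simpa using this
  have hdiff := squeeze_zero_norm (hCK t) hbound
  have hexp : Tendsto (fun n : ℕ => ((Real.exp (-(t ^ 2 / 2 * ∑ l ∈ Finset.range (n + 1),
      (2 : ℝ)⁻¹ ^ l * ∫ x, BMC.actTri P (fun y => f l y ^ 2) x ∂μ)) : ℝ) : ℂ)) atTop
      (nhds ((Real.exp (-(t ^ 2 / 2 * ∑' l : ℕ,
        (2 : ℝ)⁻¹ ^ l * ∫ x, BMC.actTri P (fun y => f l y ^ 2) x ∂μ)) : ℝ) : ℂ)) := by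
    have hs := (hsum.hasSum.tendsto_sum_nat.comp (tendsto_add_atTop_nat 1)).const_mul (t ^ 2 / 2)
    exact (Complex.continuous_ofReal.tendsto _).comp
      ((Real.continuous_exp.tendsto _).comp hs.neg)
  have := hdiff.add hexp
  simp only [sub_add_cancel, zero_add] at this
  convert this using 2
  rw [← hσ, Complex.ofReal_exp]
  congr 1
  push_cast
  ring
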